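/- Let $F$ be a field. Positive integers $b_1,\dots,b_n$ are called $F$-disjoint if $b_1+\dots+b_i<b_{i+1}$ for $1\le i\le n-1$ and, in case $\mathrm{char}(F)=p>0$, moreover $b_1+\dots+b_i<p^{v_p(b_{i+1})}$ for $1\le i\le n-1$. For an $F$-vector space $V$ let $\Gamma(V)=\bigoplus_n\Gamma^n(V)$ be its divided power algebra, with $[v]_n\in\Gamma^n(V)$ the $n$-th divided power of $v\in V$. Let $d\ge 3$, let $V$ be a $d$-dimensional $F$-vector space with basis $(e_1,\dots,e_d)$, and let $1,a_1,\dots,a_{d+1}$ be $F$-disjoint integers. Put $r=a_1+\dots+a_{d+1}$, $e_{d+1}=e_1+\dots+e_d$ and $$x=[e_1]_{a_1}[e_2]_{a_2}\cdots[e_{d+1}]_{a_{d+1}}\in\Gamma^r(V).$$ Then $x\neq 0$, and for the natural action of the group scheme $\mathrm{PGL}(V)$ on $\mathbb P(\Gamma^r(V))$, the scheme-theoretic stabiliser of the line $(x)=Fx$ is trivial: $\mathrm{Stab}_{\mathrm{PGL}(V)}((x))=\{1\}$; that is, for every commutative $F$-algebra $R$, only the identity of $\mathrm{PGL}(V)(R)$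 fixes the line spanned by $x$ in $\Gamma^r(V)\otimes_F R$. In particular: (i) if $K\supseteq F$ is an algebraically closed field and $g\in\mathrm{GL}(V\otimes_F K)$ preserves the line $K\cdot x$ in $\Gamma^r(V)\otimes_F K$, then $g$ is a homothety; (ii) if $u\in\mathrm{End}_F(V)$ and $c\in F$ satisfy $(\mathrm{Id}+\epsilon u)(x)=(1+c\epsilon)x$ in $\Gamma^r(V)\otimes_F F[\epsilon]$, where $\epsilon^2=0$, then $u\in F\cdot\mathrm{Id}$. -/

import Mathlib

open scoped TensorProduct

universe u v w x

noncomputable section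

/-- `F`-disjointness of a finite sequence of positive integers: each term is larger than the sum of
all the preceding ones and, if `char F = p > 0`, so is the largest power of `p` dividing it. -/
def FDisjoint (F : Type*) [Field F] {n : ℕ} (a : Fin n → ℕ) : Prop :=
  (∀ i, 0 < a i) ∧
  (∀ i : Fin n, 0 < i.val → ∑ j ∈ Finset.Iio i, a j < a i) ∧
  (∀ p : ℕ, p.Prime → CharP F p →
    ∀ i : Fin n, 0 < i.val → ∑ j ∈ Finset.Iio i, a j < p ^ padicValNat p (a i))

/-- The `n`-th divided power `Γⁿ(M)`: the degree `n` part of the divided power algebra `Γ(M)`,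
spanned by the products `[m₁]_{k₁} ⋯ [mₛ]_{kₛ}` with `k₁ + ⋯ + kₛ = n`. -/
def DivPow (R M : Type*) [CommRing R] [AddCommGroup M] [Module R M] (n : ℕ) :
    Submodule R (DividedPowerAlgebra R M) :=
  Submodule.span R {y | ∃ s : Multiset (ℕ × M), (s.map Prod.fst).sum = n ∧
    y = (s.map fun k => DividedPowerAlgebra.dp R k.1 k.2).prod}

namespace DivPow

/-- The element `[v₁]_{a₁} ⋯ [vₛ]_{aₛ}` of `Γ^{a₁ + ⋯ + aₛ}(M)`. -/
def symbol (R : Type*) {M : Type*} [CommRing R] [AddCommGroup M] [Module R M] {s : ℕ}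
    (a : Fin s → ℕ) (v : Fin s → M) : DivPow R M (∑ i, a i) :=
  ⟨∏ i, DividedPowerAlgebra.dp R (a i) (v i),
    Submodule.subset_span ⟨Finset.univ.val.map fun i => (a i, v i),
      by rw [Multiset.map_map]; rfl, by rw [Multiset.map_map]; rfl⟩⟩

section functoriality

variable {R M N : Type*} [CommRing R] [AddCommGroup M] [Module R M] [AddCommGroup N] [Module R N]

/-- The algebra map `Γ(M) → Γ(N)`, `[m]_k ↦ [f m]_k`, over a change of rings `R → S`, respects
degrees. -/
theorem map_mem (S : Type*) [CommRing S] [Algebra R S] [Module S N] [IsScalarTower R S N]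
    (f : M →ₗ[R] N) {n : ℕ} {y : DividedPowerAlgebra R M} (hy : y ∈ DivPow R M n) :
    DividedPowerAlgebra.map S f y ∈ DivPow S N n := by
  induction hy using Submodule.span_induction with
  | mem y hy =>
    obtain ⟨s, hs, rfl⟩ := hy
    refine Submodule.subset_span ⟨s.map fun k => (k.1, f k.2), by simpa using hs, ?_⟩
    rw [map_multiset_prod]
    simp
  | zero => simp
  | add y z _ _ hy hz => rw [map_add]; exact add_mem hy hz
  | smul r y _ hy =>
    rw [Algebra.smul_def, map_mul, AlgHom.commutes]
    have h : algebraMap R (DividedPowerAlgebra S N) r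
        = algebraMap S (DividedPowerAlgebra S N) (algebraMap R S r) := by
      rw [← DividedPowerAlgebra.coe_C (R := S) (M := N) (algebraMap R S r)]
      rfl
    rw [h, ← Algebra.smul_def]
    exact Submodule.smul_mem _ _ hy

/-- `Γⁿ(f) : Γⁿ(M) → Γⁿ(N)`. -/
def map (f : M →ₗ[R] N) (n : ℕ) : DivPow R M n →ₗ[R] DivPow R N n :=
  (DividedPowerAlgebra.map R f).toLinearMap.restrict fun _ hy => map_mem R f hy

/-- The extension of scalars `Γⁿ_R(M) → Γⁿ_S(S ⊗ M)`, `[m]_k ↦ [1 ⊗ m]_k`. -/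
def baseChange (S : Type*) [CommRing S] [Algebra R S] {n : ℕ} (y : DivPow R M n) :
    DivPow S (S ⊗[R] M) n :=
  ⟨DividedPowerAlgebra.map S (TensorProduct.mk R S M 1) y.1, map_mem S _ y.2⟩

/-- For a submodule `L` of `Γⁿ_R(M)`, the submodule `L_S` of `Γⁿ_S(S ⊗ M)` generated by `L`. -/
def extend (S : Type*) [CommRing S] [Algebra R S] {n : ℕ} (L : Submodule R (DivPow R M n)) :
    Submodule S (DivPow S (S ⊗[R] M) n) :=
  Submodule.span S (baseChange S '' (L : Set (DivPow R M n)))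

end functoriality

end DivPow

/-- The `R`-points of the projective linear group scheme of a free `R`-module `M` of finite rank:
`PGL(M)(R) = Aut_{R-alg}(End_R(M))`. -/
abbrev PGLPoints (R M : Type*) [CommRing R] [AddCommGroup M] [Module R M] : Type _ :=
  Module.End R M ≃ₐ[R] Module.End R M

/-- `g ∈ GL(S ⊗ M)` lifts the restriction to `S` of `φ ∈ PGL(M)(R)`: conjugation by `g` is the
extension of `φ` to `End_S(S ⊗ M)`. -/
def IsLift {R M : Type*} [CommRing R] [AddCommGroup M] [Module R M]
    (S : Type*) [CommRing S] [Algebra R S]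
    (g : (S ⊗[R] M) ≃ₗ[S] (S ⊗[R] M)) (φ : PGLPoints R M) : Prop :=
  ∀ f : Module.End R M,
    (φ f).baseChange S ∘ₗ g.toLinearMap = g.toLinearMap ∘ₗ f.baseChange S

/-- The `R`-points of the stabiliser in `PGL(M)` of an `R`-line `L ∈ ℙ(Γⁿ(M))(R)`.
A point `φ` of `PGL(M)(R)` need not lift to `GL(M)`, but does so locally on `Spec R`, uniquely up
to units; its action on `ℙ(Γⁿ(M))` is given locally by `Γⁿ` of the lifts. So `φ` fixes `L` if and
only if every lift `g` of `φ` over every `R`-algebra `S` satisfies `Γⁿ(g)(L_S) = L_S`. -/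
def lineStabiliser (R : Type w) (M : Type x) [CommRing R] [AddCommGroup M] [Module R M] {n : ℕ}
    (L : Submodule R (DivPow R M n)) : Set (PGLPoints R M) :=
  {φ | ∀ (S : Type w) [CommRing S] [Algebra R S] (g : (S ⊗[R] M) ≃ₗ[S] (S ⊗[R] M)),
    IsLift S g φ →
      (DivPow.extend S L).map (DivPow.map g.toLinearMap n) = DivPow.extend S L}

end

/-! The core statement is over a local `F`-algebra `S`: an automorphism `g` of `S ⊗ V` that
multiplies `x` by a unit is a homothety. Automorphisms of `End(M)` are conjugations locally on the
base (a form of Skolem–Noether), so this settles all points of `PGL`; the local rings `K` and `F[ε]`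
give the geometric and infinitesimal statements.

`Γ(M)` acts on polynomials, `[v]_n` being the `n`-th divided derivative along `v`; the constant term
of the result is a pairing that turns identities in `Γ` into identities of scalars.

In characteristic `p`, each `a_i` is divisible by a power `q` of `p` exceeding 1 plus the sum of the
earlier exponents, and `X ^ a_i` is a constant for divided derivatives of order below `q`
(Frobenius). Testing on `X ^ a_i * P` therefore strips off the top factor, and every initial product
of `x` is preserved up to a unit, as a functional on polynomials (`pairing_dp_mul_prod_X_pow_mul`).
By induction `g` scales each `e_i` (`exists_smul_of_pairing`). The last factor then compares the
scalars: the monomials of `[∑ l_i e_i]_N ∏ [e_i]_{a_i}` with unit binomial coefficients force all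
`l_i` to agree (`eq_of_prod_pow_eq`). That is where `d ≥ 3` and the leading 1 of the disjoint
sequence give the needed room.

In characteristic zero, divided powers are powers up to factorials, so `x` is in essence a product
of vectors with distinct multiplicities, and over a field unique factorisation would make `g`
preserve the line of each factor. Over a local ring this is replaced by evaluation on well-chosen
linear forms and orders of vanishing (`apply_eq_zero_of_prod_dp_eq`). Preserving the lines of the
`e_i` and of their sum leaves only homotheties. -/

namespace MvPolynomial

/-! ### Divided directional derivatives of polynomials -/

variable {σ S : Type*} [CommRing S]

/-- The Taylor expansion `P ↦ P(X + T w)` in the direction `w`. -/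
noncomputable def translate (w : σ → S) :
    MvPolynomial σ S →ₐ[S] Polynomial (MvPolynomial σ S) :=
  aeval fun i => Polynomial.C (X i) + Polynomial.C (C (w i)) * Polynomial.X

@[simp]
theorem translate_X (w : σ → S) (i : σ) :
    translate w (X i) = Polynomial.C (X i) + Polynomial.C (C (w i)) * Polynomial.X := by
  simp [translate]

/-- The `n`-th divided directional derivative: the coefficient of `T ^ n` in `P(X + T w)`. -/
noncomputable def hasse (w : σ → S) (n : ℕ) : Module.End S (MvPolynomial σ S) :=
  ((Polynomial.lcoeff (MvPolynomial σ S) n).restrictScalars S) ∘ₗ (translate w).toLinearMap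

theorem hasse_apply (w : σ → S) (n : ℕ) (P : MvPolynomial σ S) :
    hasse w n P = (translate w P).coeff n := rfl

theorem hasse_zero (w : σ → S) : hasse w 0 = 1 := by
  have h : ((Polynomial.aeval (R := MvPolynomial σ S) (0 : MvPolynomial σ S)).restrictScalars
      S).comp (translate w) = AlgHom.id S _ := by
    ext i : 1
    simp
  refine LinearMap.ext fun P => ?_
  have := DFunLike.congr_fun h P
  rw [hasse_apply, Polynomial.coeff_zero_eq_aeval_zero]
  simpa using this

theorem translate_smul (r : S) (w : σ → S) (P : MvPolynomial σ S) :
    translate (r • w) P = (translate w P).comp (Polynomial.C (C r) * Polynomial.X) := by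
  have h : translate (r • w) = ((Polynomial.aeval (R := MvPolynomial σ S)
      (Polynomial.C (C r) * Polynomial.X)).restrictScalars S).comp (translate w) := by
    ext i : 1
    simp
    ring
  rw [h]
  simp [Polynomial.comp, Polynomial.aeval_def]

theorem hasse_smul (r : S) (w : σ → S) (n : ℕ) : hasse (r • w) n = r ^ n • hasse w n := by
  refine LinearMap.ext fun P => ?_
  rw [hasse_apply, translate_smul, Polynomial.comp_C_mul_X_coeff, LinearMap.smul_apply,
    hasse_apply, smul_eq_C_mul, mul_comm, C_pow]

theorem translate_add (v w : σ → S) (P : MvPolynomial σ S) :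
    translate (v + w) P
      = Polynomial.eval₂ (translate v).toRingHom Polynomial.X (translate w P) := by
  have h : (translate (v + w)).toRingHom
      = (Polynomial.eval₂RingHom (translate v).toRingHom Polynomial.X).comp
        (translate w).toRingHom := by
    refine MvPolynomial.ringHom_ext (fun r => ?_) fun i => ?_
    · simp [translate, Polynomial.algebraMap_apply, ← MvPolynomial.algebraMap_eq]
    · have := AlgHom.commutes (translate v) (w i)
      simp only [MvPolynomial.algebraMap_eq, Polynomial.algebraMap_apply] at this
      simp [this]
      ring
  simpa using DFunLike.congr_fun h P

theorem hasse_add (v w : σ → S) (n : ℕ) :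
    hasse (v + w) n = ∑ k ∈ Finset.HasAntidiagonal.antidiagonal n, hasse v k.1 * hasse w k.2 := by
  refine LinearMap.ext fun P => ?_
  rw [hasse_apply, translate_add, Polynomial.eval₂_eq_sum_range' _ (n := (n + 1) +
    ((translate w P).natDegree + 1)) (by omega), Polynomial.finsetSum_coeff, Finset.sum_range_add,
    LinearMap.sum_apply, Finset.Nat.sum_antidiagonal_eq_sum_range_succ_mk,
    ← Finset.sum_range_reflect]
  conv_rhs => rw [← add_zero (Finset.sum _ _)]
  congr 1
  · refine Finset.sum_congr rfl fun i hi => ?_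
    have hi' : i ≤ n := by simpa [Nat.lt_succ_iff] using hi
    simp [Polynomial.coeff_mul_X_pow', hasse_apply, Nat.sub_sub_self hi']
  · refine Finset.sum_eq_zero fun i _ => ?_
    rw [Polynomial.coeff_mul_X_pow', if_neg (by omega)]


theorem _root_.Polynomial.Bivariate.coeff_coeff_swap {R : Type*} [CommRing R]
    (p : Polynomial (Polynomial R)) (m n : ℕ) :
    ((Polynomial.Bivariate.swap p).coeff m).coeff n = (p.coeff n).coeff m := by
  induction p using Polynomial.induction_on' with
  | add p q hp hq => simp [hp, hq]
  | monomial i f =>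
    induction f using Polynomial.induction_on' with
    | add p q hp hq => simp [hp, hq]
    | monomial j r =>
      rw [Polynomial.Bivariate.swap_monomial_monomial]
      simp only [Polynomial.coeff_monomial]
      split_ifs <;> simp_all [Polynomial.coeff_monomial]

theorem coeff_coeff_map_translate (v w : σ → S) (m n : ℕ) (P : MvPolynomial σ S) :
    (((translate w P).map (translate v).toRingHom).coeff n).coeff m
      = hasse v m (hasse w n P) := by
  rw [Polynomial.coeff_map]
  rfl

/-- Both sides are coefficients of the single expansion `P(X + T v + T' w)`, read with the two
parameters exchanged. -/
theorem hasse_comm (v w : σ → S) (m n : ℕ) : hasse v m * hasse w n = hasse w n * hasse v m := by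
  have h : (Polynomial.mapRingHom (translate v).toRingHom).comp (translate w).toRingHom
      = (Polynomial.Bivariate.swap (R := MvPolynomial σ S)).toRingEquiv.toRingHom.comp
        ((Polynomial.mapRingHom (translate w).toRingHom).comp (translate v).toRingHom) := by
    refine MvPolynomial.ringHom_ext (fun r => ?_) fun i => ?_
    · simp [Polynomial.Bivariate.swap_C_C]
    · simp [Polynomial.Bivariate.swap_C_C, Polynomial.Bivariate.swap_X,
        Polynomial.Bivariate.swap_Y]
      ring
  refine LinearMap.ext fun P => ?_
  have := DFunLike.congr_fun h P
  simp only [RingHom.comp_apply, Polynomial.coe_mapRingHom] at this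
  rw [Module.End.mul_apply, Module.End.mul_apply, ← coeff_coeff_map_translate,
    ← coeff_coeff_map_translate (m := n), ← Polynomial.Bivariate.coeff_coeff_swap _ n m]
  exact congrArg (fun p => (Polynomial.coeff p n).coeff m) this

/-- Translating twice along `w` gives `P(X + (T + T') w)`, a Taylor shift of the one-parameter
expansion; the binomial is a coefficient of `(T + T') ^ (m + n)`. -/
theorem hasse_mul (w : σ → S) (m n : ℕ) :
    hasse w m * hasse w n = (m + n).choose m • hasse w (m + n) := by
  have h : (Polynomial.mapRingHom (translate w).toRingHom).comp (translate w).toRingHom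
      = ((Polynomial.taylorAlgHom (Polynomial.X : Polynomial (MvPolynomial σ S))).toRingHom.comp
        (Polynomial.mapRingHom Polynomial.C)).comp (translate w).toRingHom := by
    refine MvPolynomial.ringHom_ext (fun r => ?_) fun i => ?_
    · simp
    · simp
      ring
  refine LinearMap.ext fun P => ?_
  have := DFunLike.congr_fun h P
  simp only [RingHom.comp_apply, Polynomial.coe_mapRingHom] at this
  rw [Module.End.mul_apply, ← coeff_coeff_map_translate]
  refine (congrArg (fun p => (Polynomial.coeff p n).coeff m) this).trans ?_
  have hm : (Polynomial.hasseDeriv n ((translate w P).map Polynomial.C)).eval Polynomial.X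
      = Polynomial.hasseDeriv n (translate w P) := by
    have h' : Polynomial.hasseDeriv n ((translate w P).map Polynomial.C)
        = (Polynomial.hasseDeriv n (translate w P)).map Polynomial.C := by
      ext1 k
      simp [Polynomial.hasseDeriv_coeff]
    rw [h', Polynomial.eval_map, Polynomial.eval₂_C_X]
  change ((Polynomial.taylor Polynomial.X ((translate w P).map Polynomial.C)).coeff n).coeff m = _
  rw [Polynomial.taylor_coeff, hm, Polynomial.hasseDeriv_coeff, LinearMap.smul_apply, hasse_apply,
    nsmul_eq_mul, Nat.choose_symm_add]

/-- Directional derivatives commute, so they generate a commutative algebra of operators. -/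
noncomputable def hasseAlgebra (σ S : Type*) [CommRing S] :
    Subalgebra S (Module.End S (MvPolynomial σ S)) :=
  Algebra.adjoin S (Set.range fun k : ℕ × (σ → S) => hasse k.2 k.1)

instance : IsMulCommutative (hasseAlgebra σ S) := by
  refine Algebra.isMulCommutative_adjoin S ?_
  rintro _ ⟨k, rfl⟩ _ ⟨l, rfl⟩
  exact hasse_comm _ _ _ _

theorem hasse_mem (w : σ → S) (n : ℕ) : hasse w n ∈ hasseAlgebra σ S :=
  Algebra.subset_adjoin ⟨(n, w), rfl⟩

end MvPolynomial

/-! ### The action of the divided power algebra on polynomials and the resulting pairing -/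

namespace DividedPowerAlgebra

open MvPolynomial

open scoped IsMulCommutative

variable {σ S M : Type*} [CommRing S] [AddCommGroup M] [Module S M]

/-- The action of `Γ(M)` on polynomials through a linear map `f : M → (σ → S)`, `[m]_n` acting as
the `n`-th divided derivative in the direction `f m`. -/
noncomputable def hasseAction (f : M →ₗ[S] σ → S) :
    DividedPowerAlgebra S M →ₐ[S] Module.End S (MvPolynomial σ S) :=
  (hasseAlgebra σ S).val.comp <|
    DividedPowerAlgebra.lift'
      (f := fun k : ℕ × M => (⟨hasse (f k.2) k.1, hasse_mem _ _⟩ : hasseAlgebra σ S))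
      (fun m => Subtype.ext (hasse_zero _))
      (fun n r m => Subtype.ext (by simp [hasse_smul]))
      (fun n p m => Subtype.ext (by simpa using hasse_mul _ _ _))
      (fun n p m => Subtype.ext (by simp [hasse_add]))

@[simp]
theorem hasseAction_dp (f : M →ₗ[S] σ → S) (n : ℕ) (m : M) :
    hasseAction f (dp S n m) = hasse (f m) n := by
  simp [hasseAction]

end DividedPowerAlgebra

namespace MvPolynomial

variable {σ S : Type*} [CommRing S]

/-- Putting `X = 0` in `P(X + T w)` leaves `P(T w)`. -/
theorem constantCoeff_hasse (w : σ → S) (n : ℕ) (P : MvPolynomial σ S) :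
    constantCoeff (hasse w n P)
      = (aeval (fun i => Polynomial.C (w i) * Polynomial.X) P : Polynomial S).coeff n := by
  have h : (Polynomial.mapRingHom constantCoeff).comp (translate w).toRingHom
      = (aeval (fun i => Polynomial.C (w i) * Polynomial.X) :
          MvPolynomial σ S →ₐ[S] Polynomial S).toRingHom := by
    refine MvPolynomial.ringHom_ext (fun r => ?_) fun i => ?_
    · simp [Polynomial.algebraMap_apply]
    · simp
  rw [hasse_apply, ← Polynomial.coeff_map]
  exact congrArg (fun p => Polynomial.coeff p n) (DFunLike.congr_fun h P)

theorem hasse_single_prod_X_pow [Fintype σ] [DecidableEq σ] (i : σ) (n : ℕ) (k : σ → ℕ) :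
    hasse (Pi.single i (1 : S)) n (∏ j, X j ^ (k j + if j = i then n else 0))
      = (k i + n).choose n • ∏ j, X j ^ k j := by
  rw [hasse_apply, map_prod, ← Finset.mul_prod_erase _ _ (Finset.mem_univ i),
    ← Finset.mul_prod_erase _ (fun j => X j ^ k j) (Finset.mem_univ i)]
  have h : ∏ j ∈ Finset.univ.erase i,
      translate (Pi.single i (1 : S)) (X j ^ (k j + if j = i then n else 0))
      = Polynomial.C (∏ j ∈ Finset.univ.erase i, X j ^ k j) := by
    rw [map_prod]
    refine Finset.prod_congr rfl fun j hj => ?_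
    have hj := Finset.ne_of_mem_erase hj
    simp [hj]
  rw [h, Polynomial.coeff_mul_C]
  have h2 : translate (Pi.single i (1 : S)) (X i ^ (k i + if i = i then n else 0))
      = (Polynomial.X + Polynomial.C (X i)) ^ (k i + n) := by
    simp [add_comm]
  rw [h2, Polynomial.coeff_X_add_C_pow, Nat.add_sub_cancel, nsmul_eq_mul]
  ring

end MvPolynomial

namespace DividedPowerAlgebra

open MvPolynomial

variable {σ S M : Type*} [CommRing S] [AddCommGroup M] [Module S M]

/-- The pairing of `Γ(M)` with polynomials. -/
noncomputable def pairing (f : M →ₗ[S] σ → S) (y : DividedPowerAlgebra S M)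
    (P : MvPolynomial σ S) : S :=
  constantCoeff (hasseAction f y P)

theorem pairing_smul (f : M →ₗ[S] σ → S) (c : S) (y : DividedPowerAlgebra S M)
    (P : MvPolynomial σ S) : pairing f (c • y) P = c * pairing f y P := by
  simp [pairing, smul_eq_C_mul]

theorem hasseAction_prod_dp [Fintype σ] [DecidableEq σ] (f : M →ₗ[S] σ → S) (e : σ → M)
    (he : ∀ i, f (e i) = Pi.single i 1) (b : σ → ℕ) (s : Finset σ) (n : σ → ℕ) :
    hasseAction f (∏ i ∈ s, dp S (b i) (e i)) (∏ j, X j ^ (n j + if j ∈ s then b j else 0))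
      = (∏ i ∈ s, (n i + b i).choose (b i)) • ∏ j, X j ^ n j := by
  induction s using Finset.induction_on generalizing n with
  | empty => simp
  | insert i s hi ih =>
    have hX : ∀ j, (n j + if j ∈ insert i s then b j else 0)
        = (n j + if j = i then b i else 0) + if j ∈ s then b j else 0 := by
      intro j
      by_cases hj : j = i
      · subst hj; simp [hi]
      · simp [hj]
    simp only [hX]
    rw [Finset.prod_insert hi, Finset.prod_insert hi, map_mul, Module.End.mul_apply,
      ih (fun j => n j + if j = i then b i else 0), map_nsmul, hasseAction_dp, he,
      hasse_single_prod_X_pow, ← mul_smul, mul_comm]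
    congr 2
    refine Finset.prod_congr rfl fun j hj => ?_
    rw [if_neg (fun h : j = i => hi (h ▸ hj)), add_zero]

/-- The derivatives along the basis lower the monomial to `X ^ n` at the cost of binomials, and
`[w]` then evaluates `X ^ n` at `w`. This is the formula by which all coefficients are compared
later. -/
theorem pairing_dp_mul_prod [Fintype σ] [DecidableEq σ] (f : M →ₗ[S] σ → S) (e : σ → M)
    (he : ∀ i, f (e i) = Pi.single i 1) (b n : σ → ℕ) (w : M) :
    pairing f (dp S (∑ i, n i) w * ∏ i, dp S (b i) (e i)) (∏ j, X j ^ (n j + b j))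
      = (∏ i, ((n i + b i).choose (b i) : S)) * ∏ i, f w i ^ n i := by
  have h := hasseAction_prod_dp f e he b Finset.univ n
  simp only [Finset.mem_univ, if_true] at h
  rw [pairing, map_mul, Module.End.mul_apply, h, map_nsmul, hasseAction_dp, map_nsmul,
    constantCoeff_hasse, nsmul_eq_mul]
  push_cast
  congr 1
  simp only [map_prod, map_pow, aeval_X, mul_pow, Finset.prod_mul_distrib,
    Finset.prod_pow_eq_pow_sum]
  simp only [← Polynomial.C_pow]
  rw [← map_prod, Polynomial.coeff_C_mul_X_pow, if_pos rfl]

end DividedPowerAlgebra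

/-! ### Binomial coefficients modulo `p` -/

namespace Nat

/-- In `k * C(N, k) = N * C(N - 1, k - 1)` the right side is divisible by `p ^ v`; were `C(N, k)`
prime to `p`, then `p ^ v` would divide the smaller number `k`. -/
theorem cast_choose_mul_eq_zero {S : Type*} [CommRing S] {p v : ℕ} (hp : p.Prime) [CharP S p]
    {N k : ℕ} (hN : p ^ v ∣ N) (hk : 0 < k) (hkv : k < p ^ v) : (N.choose k : S) = 0 := by
  rw [CharP.cast_eq_zero_iff S p]
  by_contra h
  obtain ⟨k, rfl⟩ : ∃ l, k = l + 1 := ⟨k - 1, by omega⟩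
  rcases N with _ | N
  · simp at h
  have h1 := Nat.add_one_mul_choose_eq N k
  have h2 : p ^ v ∣ (N + 1).choose (k + 1) * (k + 1) := h1 ▸ hN.mul_right _
  have h3 := (((Nat.Prime.coprime_iff_not_dvd hp).2 h).pow_left v).dvd_of_dvd_mul_left h2
  exact absurd (Nat.le_of_dvd hk h3) (by omega)

variable {S : Type*} [CommRing S] {p v : ℕ}

/-- In Vandermonde's sum for `C(N + k, k)` only the term taking nothing from `N` survives. -/
theorem cast_choose_add_eq_one (hp : p.Prime) [CharP S p] {N k : ℕ} (hN : p ^ v ∣ N)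
    (hkv : k < p ^ v) : ((k + N).choose N : S) = 1 := by
  rw [Nat.choose_symm_add.symm, add_comm, Nat.add_choose_eq, Nat.cast_sum,
    Finset.sum_eq_single (0, k)]
  · simp
  · rintro ⟨i, j⟩ hij hne
    have hij : i + j = k := by simpa using hij
    have hi : 0 < i := by
      rcases Nat.eq_zero_or_pos i with rfl | h
      · exact absurd (by simpa using hij) (by simpa using hne)
      · exact h
    rw [Nat.cast_mul, cast_choose_mul_eq_zero hp hN hi (by omega), zero_mul]
  · simp

/-- By Pascal's rule consecutive `C(N, k)` add up to `C(N + 1, k + 1)`, which vanishes, so the sign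
alternates. -/
theorem cast_choose_pred_eq (hp : p.Prime) [CharP S p] {N k : ℕ} (hN : p ^ v ∣ N + 1)
    (hkv : k < p ^ v) : (N.choose k : S) = (-1) ^ k := by
  induction k with
  | zero => simp
  | succ k ih =>
    have h := cast_choose_mul_eq_zero (S := S) hp hN k.succ_pos hkv
    rw [Nat.succ_eq_add_one, Nat.choose_succ_succ, Nat.cast_add, ih (by omega)] at h
    rw [pow_succ]
    linear_combination h

theorem cast_choose_pred_pred_eq (hp : p.Prime) [CharP S p] {N k : ℕ} (hN : p ^ v ∣ N + 2)
    (hkv : k < p ^ v) : (N.choose k : S) = (-1) ^ k * (k + 1) := by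
  induction k with
  | zero => simp
  | succ k ih =>
    have h := cast_choose_pred_eq (S := S) (N := N + 1) hp hN hkv
    rw [Nat.choose_succ_succ, Nat.cast_add, ih (by omega)] at h
    rw [pow_succ] at h ⊢
    push_cast
    linear_combination h

end Nat

/-! ### Characteristic `p`: stripping factors and comparing eigenvalues -/

namespace MvPolynomial

variable {σ S : Type*} [CommRing S] {p : ℕ}

/-- By Frobenius, `(X_i + w_i T) ^ p ^ k` differs from `X_i ^ p ^ k` by a multiple of `T ^ p ^ k`,
which is invisible in degree `n`. -/
theorem hasse_X_pow_char_pow_mul (hp : p.Prime) [CharP S p] (w : σ → S) {n k : ℕ}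
    (hn : n < p ^ k) (i : σ) (P : MvPolynomial σ S) :
    hasse w n (X i ^ p ^ k * P) = X i ^ p ^ k * hasse w n P := by
  have := Fact.mk hp
  rw [hasse_apply, map_mul, map_pow, translate_X, add_pow_char_pow, mul_pow, ← Polynomial.C_pow,
    ← Polynomial.C_pow, add_mul, Polynomial.coeff_add, Polynomial.coeff_C_mul, mul_assoc,
    Polynomial.coeff_C_mul, Polynomial.coeff_X_pow_mul', if_neg (by omega), mul_zero, add_zero,
    hasse_apply]

theorem hasse_X_pow_mul_of_dvd (hp : p.Prime) [CharP S p] (w : σ → S) {n k N : ℕ}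
    (hn : n < p ^ k) (hN : p ^ k ∣ N) (i : σ) (P : MvPolynomial σ S) :
    hasse w n (X i ^ N * P) = X i ^ N * hasse w n P := by
  obtain ⟨b, rfl⟩ := hN
  induction b generalizing P with
  | zero => simp
  | succ b ih =>
    rw [Nat.mul_succ, pow_add, mul_assoc, ih, hasse_X_pow_char_pow_mul hp w hn, mul_assoc]

end MvPolynomial

namespace DividedPowerAlgebra

open MvPolynomial

variable {S M : Type*} [CommRing S] [AddCommGroup M] [Module S M] {p : ℕ}

theorem hasseAction_mul_apply {σ : Type*} (f : M →ₗ[S] σ → S) (y z : DividedPowerAlgebra S M)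
    (P : MvPolynomial σ S) :
    hasseAction f (y * z) P = hasseAction f y (hasseAction f z P) := by
  rw [map_mul]
  rfl

/-- The low-order factors treat `X_i ^ N` as a constant. What is left for `[w]_N` is `X_i ^ N * Q`,
whose `T ^ N` coefficient along `T w` is `w_i ^ N * Q(0)`. So the top factor can be split off the
pairing. -/
theorem pairing_dp_mul_prod_X_pow_mul {σ ι : Type*} (hp : p.Prime) [CharP S p]
    (f : M →ₗ[S] σ → S) {k N : ℕ} (hN : p ^ k ∣ N) (s : Finset ι) (b : ι → ℕ)
    (hb : ∀ j ∈ s, b j < p ^ k) (u : ι → M) (w : M) (i : σ) (P : MvPolynomial σ S) :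
    pairing f (dp S N w * ∏ j ∈ s, dp S (b j) (u j)) (X i ^ N * P)
      = f w i ^ N * pairing f (∏ j ∈ s, dp S (b j) (u j)) P := by
  have h : hasseAction f (∏ j ∈ s, dp S (b j) (u j)) (X i ^ N * P)
      = X i ^ N * hasseAction f (∏ j ∈ s, dp S (b j) (u j)) P := by
    classical
    induction s using Finset.induction_on with
    | empty => simp
    | insert j s hj ih =>
      rw [Finset.prod_insert hj, hasseAction_mul_apply, hasseAction_mul_apply,
        ih fun l hl => hb l (Finset.mem_insert_of_mem hl), hasseAction_dp,
        hasse_X_pow_mul_of_dvd hp _ (hb j (Finset.mem_insert_self _ _)) hN]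
  rw [pairing, hasseAction_mul_apply, h, hasseAction_dp, constantCoeff_hasse, map_mul,
    map_pow, aeval_X, mul_pow, ← Polynomial.C_pow, mul_assoc, Polynomial.coeff_C_mul,
    Polynomial.coeff_X_pow_mul', if_pos le_rfl, Nat.sub_self, ← constantCoeff_hasse, hasse_zero]
  rfl

theorem prod_dp_lt_succ {N : ℕ} (a : Fin N → ℕ) (u : Fin N → M) (i : Fin N) :
    ∏ j, dp S (if j.val < i.val + 1 then a j else 0) (u j)
      = dp S (a i) (u i) * ∏ j, dp S (if j.val < i.val then a j else 0) (u j) := by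
  rw [← Finset.mul_prod_erase _ _ (Finset.mem_univ i),
    ← Finset.mul_prod_erase _ (fun j => dp S (if j.val < i.val then a j else 0) (u j))
      (Finset.mem_univ i)]
  simp only [Nat.lt_add_one, if_true, lt_irrefl, if_false, dp_zero, one_mul]
  congr 1
  refine Finset.prod_congr rfl fun j hj => ?_
  have : j.val ≠ i.val := fun h => Finset.ne_of_mem_erase hj (Fin.ext h)
  congr 1
  simp only [Nat.lt_succ_iff_lt_or_eq, this, or_false]

theorem prod_dp_smul {ι : Type*} [Fintype ι] (b : ι → ℕ) (u w : ι → M) (l : ι → S)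
    (h : ∀ i, b i ≠ 0 → u i = l i • w i) :
    ∏ i, dp S (b i) (u i) = (∏ i, l i ^ b i) • ∏ i, dp S (b i) (w i) := by
  rw [Algebra.smul_def, map_prod, ← Finset.prod_mul_distrib]
  refine Finset.prod_congr rfl fun i _ => ?_
  by_cases hb : b i = 0
  · simp [hb, dp_zero]
  · rw [h i hb, dp_smul, Algebra.smul_def]

theorem prod_pow_two {ι : Type*} [Fintype ι] [DecidableEq ι] {A : Type*} [CommMonoid A]
    {i j : ι} (hij : i ≠ j) (x y : ℕ) (F : ι → ℕ → A) (hF : ∀ t, F t 0 = 1) :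
    ∏ t, F t (if t = i then x else if t = j then y else 0) = F i x * F j y := by
  rw [Fintype.prod_eq_mul i j hij]
  · simp [hij.symm]
  · rintro t ⟨h1, h2⟩
    simp [h1, h2, hF]

theorem sum_two {ι : Type*} [Fintype ι] [DecidableEq ι] {i j : ι} (hij : i ≠ j) (x y : ℕ) :
    ∑ t, (if t = i then x else if t = j then y else 0) = x + y := by
  rw [Fintype.sum_eq_add i j hij]
  · simp [hij.symm]
  · rintro t ⟨h1, h2⟩
    simp [h1, h2]

section

variable {d : ℕ} (e : Module.Basis (Fin d) S M)

theorem equivFun_basis (i : Fin d) : e.equivFun.toLinearMap (e i) = Pi.single i 1 := by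
  simp [Finsupp.single_eq_pi_single]

/-- If `g` scales `e_j` for `b_j ≠ 0` and the line of `[e_i]_m ∏ [e_j]_{b_j}`, where `b_i = 0`, then
it scales `e_i`. -/
theorem exists_smul_of_pairing [CharP S p] (g : M →ₗ[S] M) (i : Fin d) {m : ℕ} (hm : 0 < m)
    (b : Fin d → ℕ) (hbi : b i = 0) (hb : ∀ j, p ∣ b j) (l : Fin d → S)
    (hl : ∀ j, b j ≠ 0 → g (e j) = l j • e j) (c : S) (hc : IsUnit c)
    (h : ∀ P, pairing e.equivFun.toLinearMap (dp S m (g (e i)) * ∏ j, dp S (b j) (g (e j))) P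
      = c * pairing e.equivFun.toLinearMap (dp S m (e i) * ∏ j, dp S (b j) (e j)) P) :
    ∃ r : S, IsUnit r ∧ g (e i) = r • e i := by
  set f := e.equivFun.toLinearMap with hf
  have key : ∀ n : Fin d → ℕ, ∑ t, n t = m →
      (∏ j, l j ^ b j) * ((∏ t, ((n t + b t).choose (b t) : S)) * ∏ t, f (g (e i)) t ^ n t)
      = c * ((∏ t, ((n t + b t).choose (b t) : S)) * ∏ t, f (e i) t ^ n t) := by
    rintro n rfl
    have := h (∏ j, X j ^ (n j + b j))
    rwa [prod_dp_smul b (fun j => g (e j)) (fun j => e j) l hl, mul_smul_comm, pairing_smul,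
      pairing_dp_mul_prod f e (equivFun_basis e), pairing_dp_mul_prod f e (equivFun_basis e)]
      at this
  -- Testing with the whole exponent `m` at `i` makes every binomial 1, since `b i = 0`; the `i`-th
  -- coordinate of `g (e i)` is therefore a unit.
  have h0 : (∏ j, l j ^ b j) * f (g (e i)) i ^ m = c := by
    have := key (fun t => if t = i then m else 0) (by simp)
    have hch : (∏ t, (((if t = i then m else 0) + b t).choose (b t) : S)) = 1 := by
      refine Finset.prod_eq_one fun t _ => ?_
      by_cases ht : t = i
      · subst ht; simp [hbi]
      · simp [ht]
    rw [hch] at this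
    simpa [pow_ite, hf, equivFun_basis] using this
  have hu : IsUnit ((∏ j, l j ^ b j) * f (g (e i)) i ^ m) := h0 ▸ hc
  have hL := isUnit_of_mul_isUnit_left hu
  have hw : IsUnit (f (g (e i)) i) := (isUnit_pow_iff hm.ne').1 (isUnit_of_mul_isUnit_right hu)
  refine ⟨_, hw, e.ext_elem fun j => ?_⟩
  by_cases hj : j = i
  · subst hj; simp [hf]
  · have hij : i ≠ j := fun h => hj h.symm
    -- Moving one unit of exponent from `i` to `j` isolates the `j`-th coordinate. Its binomial is
    -- `b j + 1`, equal to 1 in `S` because `p ∣ b j`.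
    have := key (fun t => if t = i then m - 1 else if t = j then 1 else 0)
      (by rw [sum_two hij]; omega)
    rw [prod_pow_two hij (m - 1) 1 (fun t x => ((x + b t).choose (b t) : S)) (by simp),
      prod_pow_two hij (m - 1) 1 (fun t x => f (g (e i)) t ^ x) (by simp),
      prod_pow_two hij (m - 1) 1 (fun t x => f (e i) t ^ x) (by simp)] at this
    have h1 : ((1 + b j).choose (b j) : S) = 1 := by
      rw [add_comm, Nat.choose_succ_self_right]
      simp [(CharP.cast_eq_zero_iff S p _).2 (hb j)]
    have h2 : f (e i) j = 0 := by simp [hf, equivFun_basis, hj]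
    rw [h1, h2, hbi] at this
    simp only [Nat.choose_zero_right, Nat.cast_one, one_mul, pow_one, mul_zero] at this
    have h3 := (hL.mul_right_eq_zero).1 this
    have h4 := ((hw.pow _).mul_right_eq_zero).1 h3
    rw [map_smul]
    have h5 : e.repr (g (e i)) j = 0 := h4
    simp [h5, hij]

end

end DividedPowerAlgebra

namespace DividedPowerAlgebra

open MvPolynomial

variable {S M : Type*} [CommRing S] [AddCommGroup M] [Module S M] {p : ℕ}

theorem prod_pow_three {ι : Type*} [Fintype ι] [DecidableEq ι] {A : Type*} [CommMonoid A]
    {i j k : ι} (hij : i ≠ j) (hik : i ≠ k) (hjk : j ≠ k) (x y z : ℕ) (F : ι → ℕ → A)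
    (hF : ∀ t, F t 0 = 1) :
    ∏ t, F t (if t = i then x else if t = j then y else if t = k then z else 0)
      = F i x * (F j y * F k z) := by
  rw [← Finset.prod_subset (Finset.subset_univ {i, j, k}), Finset.prod_insert (by simp [hij, hik]),
    Finset.prod_insert (by simp [hjk]), Finset.prod_singleton]
  · simp [hij.symm, hik.symm, hjk.symm]
  · intro t _ ht
    simp only [Finset.mem_insert, Finset.mem_singleton, not_or] at ht
    simp [ht, hF]

theorem sum_three {ι : Type*} [Fintype ι] [DecidableEq ι] {i j k : ι} (hij : i ≠ j) (hik : i ≠ k)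
    (hjk : j ≠ k) (x y z : ℕ) :
    ∑ t, (if t = i then x else if t = j then y else if t = k then z else 0) = x + (y + z) :=
  prod_pow_three (A := Multiplicative ℕ) hij hik hjk x y z (fun _ n => Multiplicative.ofAdd n)
    fun _ => rfl

/-- Diagonal scalars compatible with a nonzero multiple of `∏ [e_i]_{a_i} [∑ e_i]_N` are equal. -/
theorem eq_of_prod_pow_eq (hp : p.Prime) [CharP S p] {d : ℕ} (hd : 3 ≤ d) (a : Fin d → ℕ)
    (ha : ∀ i, 0 < a i) (k : Fin d → ℕ) (hk : ∀ i, p ^ k i ∣ a i)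
    (hlt : ∀ i, 1 + ∑ j ∈ Finset.Iio i, a j < p ^ k i) {N v : ℕ} (hN0 : 0 < N) (hN : p ^ v ∣ N)
    (hNlt : 1 + ∑ j, a j < p ^ v) (l : Fin d → S) (hl : ∀ i, IsUnit (l i)) (m c : S)
    (hm : IsUnit m)
    (h : ∀ n : Fin d → ℕ, ∑ t, n t = N → IsUnit (∏ t, ((n t + a t).choose (a t) : S)) →
      m * ∏ t, l t ^ n t = c) (i j : Fin d) : l i = l j := by
  obtain ⟨i0, hi0⟩ : ∃ i0 : Fin d, i0.val = 0 := ⟨⟨0, by omega⟩, rfl⟩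
  obtain ⟨i1, hi1⟩ : ∃ i : Fin d, i.val = 1 := ⟨⟨1, by omega⟩, rfl⟩
  obtain ⟨i2, hi2⟩ : ∃ i : Fin d, i.val = 2 := ⟨⟨2, by omega⟩, rfl⟩
  have ne01 : i0 ≠ i1 := fun h => by rw [h] at hi0; omega
  have ne02 : i0 ≠ i2 := fun h => by rw [h] at hi0; omega
  have ne12 : i1 ≠ i2 := fun h => by rw [h] at hi1; omega
  have hNle : p ^ v ≤ N := Nat.le_of_dvd hN0 hN
  have hsum : ∀ s : Finset (Fin d), i0 ∈ s → a i0 ≤ ∑ j ∈ s, a j := fun s hs =>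
    Finset.single_le_sum (f := a) (fun _ _ => Nat.zero_le _) hs
  have hsum1 : ∀ s : Finset (Fin d), i0 ∈ s → i1 ∈ s → a i0 + 1 ≤ ∑ j ∈ s, a j := by
    intro s h0 h1
    have := Finset.sum_le_sum_of_subset (f := a) (s := {i0, i1}) (t := s)
      (by
        intro x
        simp only [Finset.mem_insert, Finset.mem_singleton]
        rintro (rfl | rfl) <;> assumption)
    rw [Finset.sum_pair ne01] at this
    have := ha i1
    omega
  have hv : a i0 + 2 < p ^ v := by
    have := hsum1 Finset.univ (Finset.mem_univ _) (Finset.mem_univ _)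
    omega
  have hlt1 : ∀ j, j ≠ i0 → a i0 + 1 < p ^ k j := by
    intro j hj
    have := hsum (Finset.Iio j) (by
      rw [Finset.mem_Iio, Fin.lt_def, hi0]
      exact Nat.pos_of_ne_zero fun h => hj (Fin.ext (h.trans hi0.symm)))
    have := hlt j
    omega
  -- Two terms precede index 2, so its bound exceeds `a i0 + 2`; index 1 would only give `a i0 + 1`.
  have hlt2 : a i0 + 2 < p ^ k i2 := by
    have := hsum1 (Finset.Iio i2) (by rw [Finset.mem_Iio, Fin.lt_def]; omega)
      (by rw [Finset.mem_Iio, Fin.lt_def]; omega)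
    have := hlt i2
    omega
  have hpa : (a i0 : S) = 0 := by
    rw [CharP.cast_eq_zero_iff S p]
    refine dvd_trans (dvd_pow_self p ?_) (hk i0)
    intro h0
    have := hlt i0
    rw [h0] at this
    simp at this
  have hone : ∀ j n, n < p ^ k j → ((n + a j).choose (a j) : S) = 1 := fun j n hn =>
    Nat.cast_choose_add_eq_one hp (hk j) hn
  have hunit : ∀ n : ℕ, IsUnit ((-1 : S) ^ n) := fun n => (isUnit_one.neg).pow n
  have rel : ∀ j t, j ≠ i0 → t ≠ i0 → j ≠ t → ∀ x y z : ℕ, x + (y + z) = N → y < p ^ k j →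
      z < p ^ k t → IsUnit ((x + a i0).choose (a i0) : S) →
      m * (l i0 ^ x * (l j ^ y * l t ^ z)) = c := by
    intro j t hj ht hjt x y z hN hy hz hx
    have := h (fun s => if s = i0 then x else if s = j then y else if s = t then z else 0)
      (by rw [sum_three hj.symm ht.symm hjt, hN])
    rw [prod_pow_three hj.symm ht.symm hjt x y z (fun s x => l s ^ x) (by simp),
      prod_pow_three hj.symm ht.symm hjt x y z (fun s x => ((x + a s).choose (a s) : S))
        (by simp), hone j y hy, hone t z hz, mul_one, mul_one] at this
    exact this hx
  have pos : ∀ j, 0 < p ^ k j := fun j => pow_pos hp.pos _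
  have top : m * l i0 ^ N = c := by
    have := rel i1 i2 ne01.symm ne02.symm ne12 N 0 0 (by simp) (pos _) (pos _) (by
      rw [← Nat.choose_symm_add, add_comm N, Nat.cast_choose_add_eq_one hp hN (by omega)]
      exact isUnit_one)
    simpa using this
  have cancel : ∀ (x r : ℕ) (Y : S), x + r = N → m * (l i0 ^ x * Y) = c → Y = l i0 ^ r := by
    intro x r Y hx hY
    rw [← top, ← hx, pow_add] at hY
    exact ((hl i0).pow x).mul_left_cancel (hm.mul_left_cancel hY)
  -- Removing `r` from the exponent `N` at `i0`, with `0 < r ≤ a i0`, would give a binomial that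
  -- vanishes mod `p`. The first usable values are `r = a i0 + 1` and `a i0 + 2`, with upper entries
  -- `N - 1` and `N - 2`.
  have hpred : IsUnit ((N - (a i0 + 1) + a i0).choose (a i0) : S) := by
    rw [Nat.cast_choose_pred_eq (v := v) hp (by convert hN using 1; omega) (by omega)]
    exact hunit _
  have hpred2 : IsUnit ((N - (a i0 + 2) + a i0).choose (a i0) : S) := by
    rw [Nat.cast_choose_pred_pred_eq (v := v) hp (by convert hN using 1; omega) (by omega), hpa,
      zero_add, mul_one]
    exact hunit _
  have hpow1 : ∀ j, j ≠ i0 → l j ^ (a i0 + 1) = l i0 ^ (a i0 + 1) := by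
    intro j hj
    obtain ⟨t, ht, hjt⟩ : ∃ t, t ≠ i0 ∧ j ≠ t := by
      by_cases h : j = i1
      · exact ⟨i2, ne02.symm, h ▸ ne12⟩
      · exact ⟨i1, ne01.symm, h⟩
    have := rel j t hj ht hjt (N - (a i0 + 1)) (a i0 + 1) 0 (by omega) (hlt1 j hj) (pos _) hpred
    exact cancel (N - (a i0 + 1)) _ _ (by omega) (by simpa using this)
  -- Two distinct indices other than `i0` are available because `d ≥ 3`; against `hpow1` this
  -- identifies `l j` with `l t`.
  have hpow2 : ∀ j t, j ≠ i0 → t ≠ i0 → j ≠ t → l j ^ a i0 * l t = l i0 ^ (a i0 + 1) := by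
    intro j t hj ht hjt
    have h1 := hlt1 j hj
    have h2 := hlt1 t ht
    have := rel j t hj ht hjt (N - (a i0 + 1)) (a i0) 1 (by omega) (by omega)
      (by omega) hpred
    exact cancel (N - (a i0 + 1)) _ _ (by omega) (by simpa using this)
  have heq : ∀ j t, j ≠ i0 → t ≠ i0 → l j = l t := by
    intro j t hj ht
    by_cases hjt : j = t
    · rw [hjt]
    have := (hpow1 j hj).trans (hpow2 j t hj ht hjt).symm
    rw [pow_succ] at this
    exact ((hl j).pow _).mul_left_cancel this
  have h02 : l i2 = l i0 := by
    have := rel i2 i1 ne02.symm ne01.symm ne12.symm (N - (a i0 + 2)) (a i0 + 2) 0 (by omega) hlt2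
      (pos _) hpred2
    have h2 : l i2 ^ (a i0 + 2) = l i0 ^ (a i0 + 2) :=
      cancel (N - (a i0 + 2)) _ _ (by omega) (by simpa using this)
    rw [pow_succ, pow_succ (l i0) (a i0 + 1), hpow1 i2 ne02.symm] at h2
    exact ((hl i0).pow _).mul_left_cancel h2
  have hall : ∀ j, l j = l i0 := by
    intro j
    by_cases hj : j = i0
    · rw [hj]
    · rw [heq j i2 hj ne02.symm, h02]
  rw [hall i, hall j]

/-- In characteristic `p`, an endomorphism preserving the line of
`[e_1]_{a_1} ⋯ [e_d]_{a_d} [e_1 + ⋯ + e_d]_{a_{d+1}}` is a homothety. -/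
theorem exists_eq_smul_id_of_charP (hp : p.Prime) [CharP S p] {d : ℕ} (hd : 3 ≤ d)
    (e : Module.Basis (Fin d) S M) (a : Fin (d + 1) → ℕ) (ha : ∀ i, 0 < a i)
    (k : Fin (d + 1) → ℕ) (hk : ∀ i, p ^ k i ∣ a i)
    (hlt : ∀ i, 1 + ∑ j ∈ Finset.Iio i, a j < p ^ k i) (g : M →ₗ[S] M) (c : S) (hc : IsUnit c)
    (v : Fin (d + 1) → M) (hv : ∀ i : Fin d, v i.castSucc = e i)
    (hvl : v (Fin.last d) = ∑ i, e i)
    (h : ∏ i, dp S (a i) (g (v i)) = c • ∏ i, dp S (a i) (v i)) :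
    ∃ r : S, g = r • LinearMap.id := by
  set f := e.equivFun.toLinearMap with hf
  have hpdvd : ∀ i, p ∣ a i := by
    intro i
    refine dvd_trans (dvd_pow_self p ?_) (hk i)
    intro h0
    have := hlt i
    rw [h0] at this
    simp at this
  have hlt' : ∀ i j : Fin (d + 1), j < i → a j < p ^ k i := by
    intro i j hj
    have := Finset.single_le_sum (f := a) (fun _ _ => Nat.zero_le _) (Finset.mem_Iio.2 hj)
    have := hlt i
    omega
  have hcut : ∀ (u : Fin (d + 1) → M) (m : ℕ), m ≤ d →
      ∏ j, dp S (if j.val < m then a j else 0) (u j)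
        = ∏ j : Fin d, dp S (if j.val < m then a j.castSucc else 0) (u j.castSucc) := by
    intro u m hm
    rw [Fin.prod_univ_castSucc, Fin.val_last, if_neg (by omega), dp_zero, mul_one]
    rfl
  -- Descending from the full product, each step removes the factor of largest index by testing on
  -- `X t ^ a_m * P`, where `t` is a coordinate at which `v_m` equals 1.
  have hprefix : ∀ m, m ≤ d + 1 → ∃ c : S, IsUnit c ∧ ∀ P,
      pairing f (∏ j, dp S (if j.val < m then a j else 0) (g (v j))) P
        = c * pairing f (∏ j, dp S (if j.val < m then a j else 0) (v j)) P := by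
    intro m hm
    induction hm using Nat.decreasingInduction with
    | self =>
      refine ⟨c, hc, fun P => ?_⟩
      simp only [Fin.is_lt, if_true]
      rw [h, pairing_smul]
    | of_succ m hm ih =>
      obtain ⟨c, hc, ih⟩ := ih
      obtain ⟨t, ht⟩ : ∃ t : Fin d, f (v ⟨m, hm⟩) t = 1 := by
        rcases Nat.lt_succ_iff_lt_or_eq.1 hm with hm' | rfl
        · refine ⟨⟨m, hm'⟩, ?_⟩
          rw [show (⟨m, hm⟩ : Fin (d + 1)) = Fin.castSucc ⟨m, hm'⟩ from rfl, hv,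
            equivFun_basis, Pi.single_eq_same]
        · refine ⟨⟨0, by omega⟩, ?_⟩
          rw [show (⟨m, hm⟩ : Fin (m + 1)) = Fin.last m from rfl, hvl, map_sum]
          simp [hf, equivFun_basis, -LinearEquiv.coe_coe, Finset.sum_apply, Pi.single_apply]
      have step : ∀ P,
          f (g (v ⟨m, hm⟩)) t ^ a ⟨m, hm⟩
            * pairing f (∏ j, dp S (if j.val < m then a j else 0) (g (v j))) P
          = c * pairing f (∏ j, dp S (if j.val < m then a j else 0) (v j)) P := by
        intro P
        have hb : ∀ j ∈ (Finset.univ : Finset (Fin (d + 1))),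
            (if j.val < m then a j else 0) < p ^ k ⟨m, hm⟩ := by
          intro j _
          split_ifs with hj
          · exact hlt' _ _ hj
          · exact pow_pos hp.pos _
        have := ih (X t ^ a ⟨m, hm⟩ * P)
        rwa [prod_dp_lt_succ a (fun j => g (v j)) ⟨m, hm⟩, prod_dp_lt_succ a v ⟨m, hm⟩,
          pairing_dp_mul_prod_X_pow_mul hp f (hk ⟨m, hm⟩) _ _ hb,
          pairing_dp_mul_prod_X_pow_mul hp f (hk ⟨m, hm⟩) _ _ hb, ht, one_pow, one_mul] at this
      -- The remaining product takes the value 1 somewhere, so the scalar picked up by stripping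
      -- must be a unit.
      have hQ : pairing f (∏ j, dp S (if j.val < m then a j else 0) (v j))
          (∏ j : Fin d, X j ^ (if j.val < m then a j.castSucc else 0)) = 1 := by
        rw [hcut v m (by omega)]
        simp only [hv]
        have := pairing_dp_mul_prod f e (equivFun_basis e)
          (fun j : Fin d => if j.val < m then a j.castSucc else 0) (fun _ => 0) 0
        simpa [dp_zero] using this
      have hu : IsUnit (f (g (v ⟨m, hm⟩)) t ^ a ⟨m, hm⟩) := by
        have := step (∏ j : Fin d, X j ^ (if j.val < m then a j.castSucc else 0))
        rw [hQ, mul_one] at this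
        exact isUnit_of_mul_isUnit_left (this ▸ hc)
      obtain ⟨r, hr⟩ := hu
      refine ⟨↑r⁻¹ * c, r⁻¹.isUnit.mul hc, fun P => ?_⟩
      have := step P
      rw [← hr] at this
      rw [mul_assoc, ← this, ← mul_assoc, Units.inv_mul, one_mul]
  have hline : ∀ i : Fin d, ∃ r : S, IsUnit r ∧ g (e i) = r • e i := by
    intro i
    induction i using WellFoundedLT.induction with
    | ind i ih =>
      choose! l hl using ih
      obtain ⟨c, hc, hP⟩ := hprefix (i.val + 1) (by omega)
      refine exists_smul_of_pairing e g i (ha i.castSucc)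
        (fun j => if j.val < i.val then a j.castSucc else 0) (by simp) ?_ l ?_ c hc ?_
      · intro j
        split_ifs
        · exact hpdvd _
        · exact dvd_zero _
      · intro j hj
        by_cases hji : j < i
        · exact (hl j hji).2
        · simp [show ¬ j.val < i.val from hji] at hj
      · intro P
        have := hP P
        rw [hcut (fun j => g (v j)) _ i.isLt, hcut v _ i.isLt] at this
        simp only [hv] at this
        rwa [prod_dp_lt_succ (fun j : Fin d => a j.castSucc) (fun j => g (e j)) i,
          prod_dp_lt_succ (fun j : Fin d => a j.castSucc) e i] at this
  choose l hlu hl using hline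
  have hsum : ∀ i : Fin d, ∑ j ∈ Finset.Iio i, a j.castSucc
      = ∑ j ∈ Finset.Iio i.castSucc, a j := by
    intro i
    rw [← Fin.map_castSuccEmb_Iio, Finset.sum_map]
    rfl
  have hsuml : ∑ j : Fin d, a j.castSucc = ∑ j ∈ Finset.Iio (Fin.last d), a j := by
    rw [Fin.Iio_last_eq_map, Finset.sum_map]
    rfl
  have heq := eq_of_prod_pow_eq hp hd (fun i => a i.castSucc) (fun i => ha _)
    (fun i => k i.castSucc) (fun i => hk _) (fun i => by rw [hsum]; exact hlt _) (ha (Fin.last d))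
    (hk (Fin.last d)) (by rw [hsuml]; exact hlt _) l hlu (∏ i : Fin d, l i ^ a i.castSucc) c
    (by
      rw [IsUnit.prod_univ_iff]
      exact fun i => (hlu i).pow _) ?_
  · refine ⟨l ⟨0, by omega⟩, e.ext fun i => ?_⟩
    rw [hl, heq i ⟨0, by omega⟩]
    rfl
  · intro n hn hu
    -- Now `g` is diagonal, and pairing with `X ^ (n + a)` extracts the same binomial product on
    -- both sides; it cancels when it is a unit.
    have hg : g (v (Fin.last d)) = ∑ i, l i • e i := by
      rw [hvl, map_sum]
      exact Finset.sum_congr rfl fun i _ => hl i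
    rw [Fin.prod_univ_castSucc, Fin.prod_univ_castSucc] at h
    simp only [hv] at h
    rw [prod_dp_smul (fun i : Fin d => a i.castSucc) (fun i => g (e i)) e l fun i _ => hl i, hg,
      hvl, smul_mul_assoc, mul_comm, mul_comm (∏ i : Fin d, dp S (a i.castSucc) (e i)), ← hn] at h
    have := congrArg
      (fun y => pairing f y (∏ j : Fin d, X j ^ (n j + a j.castSucc))) h
    simp only [pairing_smul] at this
    rw [pairing_dp_mul_prod f e (equivFun_basis e), pairing_dp_mul_prod f e (equivFun_basis e)]
      at this
    have h1 : ∀ t, f (∑ i, l i • e i) t = l t := by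
      intro t
      simp [hf, equivFun_basis, -LinearEquiv.coe_coe, Finset.sum_apply, Pi.single_apply]
    have h2 : ∀ t, f (∑ i, e i) t = 1 := by
      intro t
      simp [hf, equivFun_basis, -LinearEquiv.coe_coe, Finset.sum_apply, Pi.single_apply]
    simp only [h1, h2, one_pow, Finset.prod_const_one, mul_one] at this
    refine hu.mul_left_cancel ?_
    rw [mul_comm _ c, ← this]
    ring

end DividedPowerAlgebra

/-! ### Characteristic zero: orders of vanishing -/

namespace Polynomial

variable {R : Type*} [CommRing R]

theorem X_pow_dvd_of_dvd_mul {p h : Polynomial R} (hh : IsRegular (h.coeff 0)) {n : ℕ}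
    (hd : X ^ n ∣ p * h) : X ^ n ∣ p := by
  induction n generalizing p with
  | zero => simp
  | succ n ih =>
    have h1 : X ∣ p * h := (dvd_pow_self X n.succ_ne_zero).trans hd
    rw [X_dvd_iff, mul_coeff_zero] at h1
    have h2 : X ∣ p := X_dvd_iff.2 (hh.right.mul_right_eq_zero_iff.1 h1)
    obtain ⟨q, rfl⟩ := h2
    obtain ⟨r, hr⟩ := hd
    rw [pow_succ', mul_assoc, mul_assoc] at hr
    rw [pow_succ']
    exact mul_dvd_mul_left X (ih ⟨r, (monic_X.isRegular.left hr)⟩)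

/-- After cancelling `h`, the coefficient of `X ^ (n - 1)` is the one that is linear in `w`. Using
it, rather than `w ^ n`, avoids any assumption that the ring is reduced. -/
theorem mul_eq_zero_of_X_pow_dvd {a w : R} {n : ℕ} (hn : 0 < n) {h : Polynomial R}
    (hh : IsRegular (h.coeff 0)) (hd : X ^ n ∣ (C w + C a * X) ^ n * h) :
    w * (n : R) * a ^ (n - 1) = 0 := by
  have h1 := X_pow_dvd_iff.1 (X_pow_dvd_of_dvd_mul hh hd) (n - 1) (by omega)
  have h2 : (C w + C a * X) ^ n = ((X + C w) ^ n).comp (C a * X) := by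
    simp [add_comm]
  rw [h2, comp_C_mul_X_coeff, coeff_X_add_C_pow] at h1
  have h3 : n - (n - 1) = 1 := by omega
  have h4 : n.choose (n - 1) = n := by
    rw [Nat.choose_symm_of_eq_add (b := 1) (by omega), Nat.choose_one_right]
  rwa [h3, h4, pow_one] at h1

theorem eq_of_X_pow_mul_eq {h h' : Polynomial R} {m n : ℕ} (hh : h.coeff 0 ≠ 0)
    (hh' : h'.coeff 0 ≠ 0) (H : X ^ m * h = X ^ n * h') : m = n := by
  rcases lt_trichotomy m n with hlt | rfl | hlt
  · have := congrArg (fun p => coeff p m) H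
    simp only [coeff_X_pow_mul', le_refl, if_true, Nat.sub_self, if_neg (not_le.2 hlt)] at this
    exact absurd this hh
  · rfl
  · have := congrArg (fun p => coeff p n) H
    simp only [coeff_X_pow_mul', le_refl, if_true, Nat.sub_self, if_neg (not_le.2 hlt)] at this
    exact absurd this.symm hh'

end Polynomial

/-! ### Characteristic zero: products of powers over a local ring -/

namespace DividedPowerAlgebra

variable {S M ι : Type*} [CommRing S] [AddCommGroup M] [Module S M]

/-- A linear map into a `ℚ`-algebra extends to `Γ(M)` by `[m]_n ↦ f(m) ^ n / n!`; multiplying by the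
factorials clears denominators. -/
theorem prod_pow_eq_of_prod_dp_eq [Fintype ι] {B : Type*} [CommRing B] [Algebra S B] [Algebra ℚ B]
    (a : ι → ℕ) (u v : ι → M) (c : S) (h : ∏ i, dp S (a i) (u i) = c • ∏ i, dp S (a i) (v i))
    (f : M →ₗ[S] B) : ∏ i, f (u i) ^ a i = c • ∏ i, f (v i) ^ a i := by
  classical
  let F := DividedPowerAlgebra.lift (DividedPowers.RatAlgebra.dividedPowers (⊤ : Ideal B)) f
    fun _ => trivial
  have hF : ∀ m, F (dp S 1 m) = f m := fun m => by
    rw [← embed_def]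
    exact lift_embed_apply _ _ m
  have hpow : ∀ w : ι → M, ∏ i, f (w i) ^ a i
      = F ((∏ i, ((a i).factorial : DividedPowerAlgebra S M)) * ∏ i, dp S (a i) (w i)) := by
    intro w
    rw [← Finset.prod_mul_distrib, map_prod]
    refine Finset.prod_congr rfl fun i _ => ?_
    rw [natFactorial_mul_dp_eq, map_pow, hF]
  rw [hpow, hpow, h, mul_smul_comm, map_smul]

variable [Algebra ℚ S] [IsLocalRing S]

/-- If each of finitely many vectors takes an invertible value under some linear form vanishing at
`v₀`, then a single such linear form serves for all of them. -/
theorem exists_dual_forall_isUnit {τ : Type*} [Finite τ] (v₀ : M) (m : τ → M)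
    (h : ∀ t, ∃ f : Module.Dual S M, f v₀ = 0 ∧ IsUnit (f (m t))) :
    ∃ f : Module.Dual S M, f v₀ = 0 ∧ ∀ t, IsUnit (f (m t)) := by
  -- A vector space over the infinite field `ℚ` is not a finite union of proper subspaces; here the
  -- subspaces are the forms with non-unit value at a given `m t`.
  let E : Submodule ℚ (M →ₗ[S] S) :=
    { carrier := {f | f v₀ = 0}
      add_mem' := fun {f g} hf hg => by
        simp only [Set.mem_ofPred_eq] at hf hg ⊢
        simp [hf, hg]
      zero_mem' := by simp
      smul_mem' := fun q f hf => by
        simp only [Set.mem_ofPred_eq] at hf ⊢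
        simp [hf] }
  let p : τ → Submodule ℚ E := fun t =>
    { carrier := {f | f.1 (m t) ∈ IsLocalRing.maximalIdeal S}
      add_mem' := fun {f g} hf hg => by
        simp only [Set.mem_ofPred_eq] at hf hg ⊢
        exact Ideal.add_mem _ hf hg
      zero_mem' := by simp
      smul_mem' := fun q f hf => by
        simp only [Set.mem_ofPred_eq] at hf ⊢
        have : (q • f).1 (m t) = algebraMap ℚ S q * f.1 (m t) := by
          rw [← Algebra.smul_def]
          rfl
        rw [this]
        exact Ideal.mul_mem_left _ _ hf }
  obtain ⟨f, hf⟩ := Submodule.exists_forall_notMem_of_forall_ne_top (K := ℚ) (M := E) p fun t ht => by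
    obtain ⟨f, hf, hu⟩ := h t
    have : (⟨f, hf⟩ : E) ∈ p t := ht ▸ Submodule.mem_top
    exact (IsLocalRing.mem_maximalIdeal _).1 this hu
  refine ⟨f.1, f.2, fun t => ?_⟩
  have := hf t
  by_contra hu
  exact this ((IsLocalRing.mem_maximalIdeal _).2 hu)

open Polynomial in
/-- Over a local `ℚ`-algebra, an automorphism preserving the line of `∏ [v_i]_{a_i}`, with distinct
exponents and pairwise independent vectors, maps each `v_i` into the line it spans. -/
theorem apply_eq_zero_of_prod_dp_eq [Fintype ι] [DecidableEq ι] (a : ι → ℕ) (ha : ∀ i, 0 < a i)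
    (hinj : Function.Injective a) (v : ι → M)
    (hone : ∀ i, ∃ f : Module.Dual S M, f (v i) = 1)
    (hsep : ∀ i j, i ≠ j → ∃ f : Module.Dual S M, f (v i) = 0 ∧ f (v j) = 1) (g : M ≃ₗ[S] M)
    (c : S) (hc : IsUnit c)
    (h : ∏ i, dp S (a i) (g (v i)) = c • ∏ i, dp S (a i) (v i)) (i : ι) (z : Module.Dual S M)
    (hz : z (v i) = 0) : z (g (v i)) = 0 := by
  obtain ⟨η, hη⟩ := hone i
  -- `J l` says that, as far as linear forms detect, `g (v l)` lies on the line of `v i` modulo the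
  -- maximal ideal. Exactly one `l` satisfies it, and the exponents will show that it is `i`.
  let J : ι → Prop := fun l => ∀ f : Module.Dual S M, f (v i) = 0 → ¬ IsUnit (f (g (v l)))
  have key : ∀ l, J l → ∀ f : Module.Dual S M, f (v l) = 1 →
      IsUnit (f (g.symm (v i)) * η (g (v l))) := by
    intro l hl f hf
    have := hl (f ∘ₗ g.symm.toLinearMap - f (g.symm (v i)) • η) (by simp [hη])
    simp only [LinearMap.sub_apply, LinearMap.comp_apply, LinearEquiv.coe_coe,
      LinearEquiv.symm_apply_apply, hf, LinearMap.smul_apply, smul_eq_mul] at this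
    exact (IsLocalRing.isUnit_or_isUnit_one_sub_self _).resolve_right this
  have hJη : ∀ l, J l → IsUnit (η (g (v l))) := by
    intro l hl
    obtain ⟨f, hf⟩ := hone l
    exact isUnit_of_mul_isUnit_right (key l hl f hf)
  have hJ : ∀ l l', J l → J l' → l = l' := by
    intro l l' hl hl'
    by_contra hne
    obtain ⟨f, hf0, hf1⟩ := hsep l l' hne
    have h1 := isUnit_of_mul_isUnit_left (key l' hl' f hf1)
    refine hl (f ∘ₗ g.symm.toLinearMap - f (g.symm (v i)) • η) (by simp [hη]) ?_
    simp only [LinearMap.sub_apply, LinearMap.comp_apply, LinearEquiv.coe_coe,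
      LinearEquiv.symm_apply_apply, hf0, LinearMap.smul_apply, smul_eq_mul, zero_sub]
    exact (h1.mul (hJη l hl)).neg
  obtain ⟨y, hy0, hy⟩ := exists_dual_forall_isUnit (v i)
    (Sum.elim (fun l : {l // l ≠ i} => v l) fun l : {l // ¬ J l} => g (v l)) (by
      rintro (⟨l, hl⟩ | ⟨l, hl⟩)
      · obtain ⟨f, hf0, hf1⟩ := hsep i l fun h => hl h.symm
        exact ⟨f, hf0, by simp [hf1]⟩
      · simp only [J, not_forall, not_not] at hl
        obtain ⟨f, hf0, hf1⟩ := hl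
        exact ⟨f, hf0, hf1⟩)
  have hyv : ∀ l, l ≠ i → IsUnit (y (v l)) := fun l hl => hy (Sum.inl ⟨l, hl⟩)
  have hyg : ∀ l, ¬ J l → IsUnit (y (g (v l))) := fun l hl => hy (Sum.inr ⟨l, hl⟩)
  have hid := prod_pow_eq_of_prod_dp_eq (B := S[X]) a (fun l => g (v l)) v c h
    (y.smulRight 1 + η.smulRight X)
  simp only [LinearMap.add_apply, LinearMap.smulRight_apply, smul_eq_C_mul, mul_one] at hid
  -- Otherwise `y` would take unit values at all `g (v l)`, while `y (v i) = 0` kills the other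
  -- side.
  have hex : ∃ j, J j := by
    by_contra hno
    push Not at hno
    have := congrArg (fun p => coeff p 0) hid
    simp only [coeff_zero_eq_eval_zero, eval_prod, eval_pow, eval_add, eval_mul, eval_C, eval_X,
      mul_zero, add_zero] at this
    have h0 : ∏ l, y (v l) ^ a l = 0 :=
      Finset.prod_eq_zero (Finset.mem_univ i) (by rw [hy0, zero_pow (ha i).ne'])
    rw [h0, mul_zero] at this
    refine not_isUnit_zero (M₀ := S) (this ▸ ?_)
    rw [IsUnit.prod_univ_iff]
    exact fun l => (hyg l (hno l)).pow _
  obtain ⟨j, hj⟩ := hex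
  -- Over the residue field both sides, as polynomials in `X`, vanish at 0 to exact orders `a j` and
  -- `a i`. The reduction is needed since `y (g (v j))` is only known to be a non-unit.
  have hji : j = i := by
    refine hinj ?_
    set π := IsLocalRing.residue S with hπ
    have hu : ∀ r : S, IsUnit r → π r ≠ 0 := fun r hr =>
      (hr.map π).ne_zero
    have hid' := congrArg (Polynomial.map π) hid
    rw [Polynomial.map_mul, Polynomial.map_prod, Polynomial.map_prod] at hid'
    rw [← Finset.mul_prod_erase _ _ (Finset.mem_univ j),
      ← Finset.mul_prod_erase _ (fun x => Polynomial.map π ((C (y (v x)) + C (η (v x)) * X) ^ a x))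
        (Finset.mem_univ i)] at hid'
    have h0 : π (y (g (v j))) = 0 := by
      rw [hπ, IsLocalRing.residue_eq_zero_iff, IsLocalRing.mem_maximalIdeal]
      exact hj y hy0
    simp only [Polynomial.map_pow, Polynomial.map_add, Polynomial.map_mul, map_C, map_X, h0, hy0,
      hη, map_zero, map_one, zero_add, one_mul, mul_pow] at hid'
    rw [mul_comm (C _ ^ _), mul_assoc, mul_left_comm (C (π c))] at hid'
    refine eq_of_X_pow_mul_eq ?_ ?_ hid'
    · simp only [coeff_zero_eq_eval_zero, eval_prod, eval_pow, eval_add, eval_mul, eval_C, eval_X,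
        mul_zero, add_zero]
      refine mul_ne_zero (pow_ne_zero _ (hu _ (hJη j hj))) (Finset.prod_ne_zero_iff.2 ?_)
      intro l hl
      exact pow_ne_zero _ (hu _ (hyg l fun hl' => Finset.ne_of_mem_erase hl (hJ _ _ hl' hj)))
    · simp only [coeff_zero_eq_eval_zero, eval_prod, eval_pow, eval_add, eval_mul, eval_C, eval_X,
        mul_zero, add_zero]
      refine mul_ne_zero (hu _ hc) (Finset.prod_ne_zero_iff.2 ?_)
      intro l hl
      exact pow_ne_zero _ (hu _ (hyv l (Finset.ne_of_mem_erase hl)))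
  subst hji
  -- The outer variable, paired with `η`, records the order of vanishing. The inner one, paired with
  -- `y`, makes the values of the other factors regular although the `z (g (v l))` may be zero
  -- divisors.
  have hid2 := prod_pow_eq_of_prod_dp_eq (B := S[X][X]) a (fun l => g (v l)) v c h
    (z.smulRight 1 + y.smulRight (C X) + η.smulRight X)
  have hval : ∀ m, (z.smulRight 1 + y.smulRight (C X) + η.smulRight X : M →ₗ[S] S[X][X]) m
      = C (C (z m) + C (y m) * X) + C (C (η m)) * X := by
    intro m
    simp [Algebra.smul_def, Polynomial.algebraMap_apply]
  simp only [hval] at hid2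
  rw [← Finset.mul_prod_erase _ _ (Finset.mem_univ j),
    ← Finset.mul_prod_erase _ (fun x => (C (C (z (v x)) + C (y (v x)) * X)
      + C (C (η (v x))) * X : S[X][X]) ^ a x) (Finset.mem_univ j), hz, hy0, hη] at hid2
  have hreg : ∀ l ∈ Finset.univ.erase j,
      IsRegular (C (z (g (v l))) + C (y (g (v l))) * X : S[X]) := by
    intro l hl
    obtain ⟨r, hr⟩ := hyg l fun hl' => Finset.ne_of_mem_erase hl (hJ _ _ hl' hj)
    have : (C (z (g (v l))) + C (y (g (v l))) * X : S[X])
        = C (r : S) * (X + C (↑r⁻¹ * z (g (v l)))) := by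
      rw [← hr, mul_add, ← C_mul, ← mul_assoc, Units.mul_inv, one_mul, add_comm]
    rw [this]
    exact ((r.isUnit.map C).isRegular).mul (monic_X_add_C _).isRegular
  have := mul_eq_zero_of_X_pow_dvd (ha j) (a := C (η (g (v j))))
    (w := C (z (g (v j))) + C (y (g (v j))) * X)
    (h := ∏ l ∈ Finset.univ.erase j, (C (C (z (g (v l))) + C (y (g (v l))) * X)
      + C (C (η (g (v l)))) * X : S[X][X]) ^ a l) ?_ ?_
  · have h1 := congrArg (fun p => coeff p 0) this
    simp only [coeff_zero_eq_eval_zero, eval_pow, eval_add, eval_mul, eval_C, eval_X, mul_zero,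
      add_zero, eval_natCast, eval_zero] at h1
    have hu : IsUnit ((a j : S)) := by
      have : (a j : S) = algebraMap ℚ S (a j) := by simp
      rw [this]
      exact (IsUnit.mk0 _ (by exact_mod_cast (ha j).ne')).map _
    exact (hu.mul_left_eq_zero).1 ((((hJη j hj).pow _).mul_left_eq_zero).1 h1)
  · simp only [coeff_zero_eq_eval_zero, eval_prod, eval_pow, eval_add, eval_mul, eval_C, eval_X,
      mul_zero, add_zero]
    refine Finset.prod_induction _ IsRegular (fun _ _ => IsRegular.mul) isRegular_one ?_
    exact fun l hl => (hreg l hl).pow _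
  · rw [hid2]
    simp only [map_zero, map_one, zero_mul, add_zero, one_mul, zero_add]
    rw [Algebra.smul_def]
    exact (dvd_mul_right _ _).mul_left _

end DividedPowerAlgebra

namespace DividedPowerAlgebra

variable {S M : Type*} [CommRing S] [AddCommGroup M] [Module S M]

/-- Over a local `ℚ`-algebra, an automorphism preserving the line of
`[e_1]_{a_1} ⋯ [e_d]_{a_d} [e_1 + ⋯ + e_d]_{a_{d+1}}` is a homothety. -/
theorem exists_eq_smul_id_of_rat [Algebra ℚ S] [IsLocalRing S] {d : ℕ} (hd : 3 ≤ d)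
    (e : Module.Basis (Fin d) S M) (a : Fin (d + 1) → ℕ) (ha : ∀ i, 0 < a i)
    (hinj : Function.Injective a) (g : M ≃ₗ[S] M) (c : S) (hc : IsUnit c)
    (v : Fin (d + 1) → M) (hv : ∀ i : Fin d, v i.castSucc = e i)
    (hvl : v (Fin.last d) = ∑ i, e i)
    (h : ∏ i, dp S (a i) (g (v i)) = c • ∏ i, dp S (a i) (v i)) :
    ∃ r : S, g.toLinearMap = r • LinearMap.id := by
  obtain ⟨i0, hi0⟩ : ∃ i0 : Fin d, i0.val = 0 := ⟨⟨0, by omega⟩, rfl⟩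
  have hne : ∀ i : Fin d, ∃ j, j ≠ i := fun i => by
    have : Nontrivial (Fin d) := Fin.nontrivial_iff_two_le.2 (by omega)
    exact exists_ne i
  have hcoord : ∀ i j, e.coord i (e j) = if j = i then 1 else 0 := fun i j => by
    simp [Finsupp.single_apply]
  have hcoordl : ∀ i, e.coord i (v (Fin.last d)) = 1 := fun i => by
    rw [hvl, map_sum]
    simp only [hcoord, Finset.sum_ite_eq', Finset.mem_univ, if_true]
  have hfix := apply_eq_zero_of_prod_dp_eq a ha hinj v (fun i => by
    induction i using Fin.lastCases with
    | last => exact ⟨e.coord i0, hcoordl i0⟩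
    | cast i => exact ⟨e.coord i, by rw [hv, hcoord, if_pos rfl]⟩) (fun i j hij => by
    induction i using Fin.lastCases with
    | last =>
      induction j using Fin.lastCases with
      | last => exact absurd rfl hij
      | cast j =>
        obtain ⟨t, ht⟩ := hne j
        exact ⟨e.coord j - e.coord t, by simp only [LinearMap.sub_apply, hcoordl, sub_self],
          by simp only [LinearMap.sub_apply, hv, hcoord, if_true, if_neg ht.symm, sub_zero]⟩
    | cast i =>
      induction j using Fin.lastCases with
      | last =>
        obtain ⟨t, ht⟩ := hne i
        exact ⟨e.coord t, by rw [hv, hcoord, if_neg ht.symm], hcoordl t⟩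
      | cast j =>
        have hij' : i ≠ j := fun h => hij (by rw [h])
        exact ⟨e.coord j, by rw [hv, hcoord, if_neg hij'], by rw [hv, hcoord, if_pos rfl]⟩)
    g c hc h
  have hoff : ∀ i j, j ≠ i → e.coord j (g (e i)) = 0 := fun i j hij => by
    have := hfix i.castSucc (e.coord j) (by rw [hv, hcoord, if_neg hij.symm])
    rwa [hv] at this
  have hsum : ∀ i, e.coord i (g (v (Fin.last d))) = e.coord i (g (e i)) := fun i => by
    rw [hvl, map_sum, map_sum, Finset.sum_eq_single i]
    · exact fun j _ hj => hoff j i hj.symm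
    · simp
  -- The difference of two coordinates vanishes on `∑ e_i`, hence also on its image.
  have hdiag : ∀ i, e.coord i (g (e i)) = e.coord i0 (g (e i0)) := fun i => by
    have := hfix (Fin.last d) (e.coord i - e.coord i0)
      (by simp only [LinearMap.sub_apply, hcoordl, sub_self])
    rw [LinearMap.sub_apply, hsum, hsum] at this
    exact sub_eq_zero.1 this
  refine ⟨e.coord i0 (g (e i0)), e.ext fun i => e.ext_elem fun j => ?_⟩
  change e.coord j (g (e i)) = e.coord j (e.coord i0 (g (e i0)) • e i)
  rw [map_smul, hcoord]
  split_ifs with hij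
  · rw [← hij, hdiag, smul_eq_mul, mul_one]
  · rw [hoff i j fun h => hij h.symm, smul_zero]

end DividedPowerAlgebra

/-! ### Consequences of disjointness -/

namespace FDisjoint

variable {F : Type*} [Field F] {N : ℕ} {a : Fin N → ℕ}

theorem pos_of_cons (ha : FDisjoint F (Fin.cons 1 a : Fin (N + 1) → ℕ)) (i : Fin N) : 0 < a i := by
  simpa using ha.1 i.succ

theorem sum_Iio_succ_cons (a : Fin N → ℕ) (i : Fin N) :
    ∑ j ∈ Finset.Iio i.succ, (Fin.cons 1 a : Fin (N + 1) → ℕ) j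
      = 1 + ∑ j ∈ Finset.Iio i, a j := by
  have h1 : ∀ (n : ℕ) (i : Fin n), Finset.Iio i = Finset.univ.filter (· < i) := fun n i => by
    ext; simp
  rw [h1, h1, Finset.sum_filter, Finset.sum_filter, Fin.sum_univ_succ]
  simp

theorem sum_lt_of_cons (ha : FDisjoint F (Fin.cons 1 a : Fin (N + 1) → ℕ)) (i : Fin N) :
    1 + ∑ j ∈ Finset.Iio i, a j < a i := by
  have := ha.2.1 i.succ (by simp)
  rwa [sum_Iio_succ_cons, Fin.cons_succ] at this

theorem sum_lt_pow_of_cons (ha : FDisjoint F (Fin.cons 1 a : Fin (N + 1) → ℕ)) {p : ℕ}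
    (hp : p.Prime) [CharP F p] (i : Fin N) :
    1 + ∑ j ∈ Finset.Iio i, a j < p ^ padicValNat p (a i) := by
  have := ha.2.2 p hp inferInstance i.succ (by simp)
  rwa [sum_Iio_succ_cons, Fin.cons_succ] at this

theorem injective_of_cons (ha : FDisjoint F (Fin.cons 1 a : Fin (N + 1) → ℕ)) :
    Function.Injective a := by
  refine StrictMono.injective fun j i hj => ?_
  have := Finset.single_le_sum (f := a) (fun _ _ => Nat.zero_le _) (Finset.mem_Iio.2 hj)
  have := ha.sum_lt_of_cons i
  omega

/-- In characteristic `p` the binomial is 1, since the last exponent is divisible by a power of `p`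
larger than each earlier one; in characteristic zero positivity is enough. -/
theorem choose_cast_ne_zero {d : ℕ} {a : Fin (d + 1) → ℕ}
    (ha : FDisjoint F (Fin.cons 1 a : Fin (d + 2) → ℕ)) (i : Fin d) :
    ((a (Fin.last d) + a i.castSucc).choose (a i.castSucc) : F) ≠ 0 := by
  obtain ⟨p, hp⟩ := CharP.exists F
  rcases CharP.char_is_prime_or_zero F p with hprime | rfl
  · rw [← Nat.choose_symm_add, add_comm, Nat.cast_choose_add_eq_one hprime pow_padicValNat_dvd]
    · exact one_ne_zero
    · have := Finset.single_le_sum (f := a) (fun _ _ => Nat.zero_le _)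
        (Finset.mem_Iio.2 (Fin.castSucc_lt_last i))
      have := ha.sum_lt_pow_of_cons hprime (Fin.last d)
      omega
  · have := CharP.charP_to_charZero F
    exact_mod_cast (Nat.choose_pos (Nat.le_add_left _ _)).ne'

end FDisjoint

/-! ### Local `F`-algebras in any characteristic -/

namespace DividedPowerAlgebra

open MvPolynomial

variable {F S M : Type*} [Field F] [CommRing S] [Algebra F S] [AddCommGroup M] [Module S M]
  {d : ℕ} {a : Fin (d + 1) → ℕ} {v : Fin (d + 1) → M}

/-- The monomial that puts the whole last exponent on the first variable pairs to a binomial that is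
nonzero in `F`. Hence `x` is nonzero, and its scalar multiples determine the scalar over every
`F`-algebra. -/
theorem exists_pairing_isUnit (hd : 3 ≤ d) (ha : FDisjoint F (Fin.cons 1 a : Fin (d + 2) → ℕ))
    (e : Module.Basis (Fin d) S M) (hv : ∀ i : Fin d, v i.castSucc = e i)
    (hvl : v (Fin.last d) = ∑ i, e i) :
    ∃ P, IsUnit (pairing e.equivFun.toLinearMap (∏ i, dp S (a i) (v i)) P) := by
  obtain ⟨i0, hi0⟩ : ∃ i0 : Fin d, i0.val = 0 := ⟨⟨0, by omega⟩, rfl⟩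
  have h := pairing_dp_mul_prod e.equivFun.toLinearMap e (equivFun_basis e)
    (fun i => a i.castSucc) (fun i => if i = i0 then a (Fin.last d) else 0) (∑ i, e i)
  have h1 : ∀ t, e.equivFun.toLinearMap (∑ i, e i) t = 1 := by
    intro t
    simp [equivFun_basis, -LinearEquiv.coe_coe, Finset.sum_apply, Pi.single_apply]
  have h2 : (∏ i, (((if i = i0 then a (Fin.last d) else 0) + a i.castSucc).choose
      (a i.castSucc) : S)) = ((a (Fin.last d) + a i0.castSucc).choose (a i0.castSucc) : S) := by
    rw [Finset.prod_eq_single i0 (fun t _ ht => by simp [ht]) (by simp), if_pos rfl]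
  rw [h2] at h
  simp only [h1, one_pow, Finset.prod_const_one, mul_one, Finset.sum_ite_eq', Finset.mem_univ,
    if_true] at h
  refine ⟨∏ j, X j ^ ((if j = i0 then a (Fin.last d) else 0) + a j.castSucc), ?_⟩
  rw [Fin.prod_univ_castSucc, mul_comm, hvl]
  simp only [hv]
  rw [h, ← map_natCast (algebraMap F S)]
  exact (IsUnit.mk0 _ (ha.choose_cast_ne_zero i0)).map _

/-- Over a local `F`-algebra, an automorphism preserving the line of
`[e_1]_{a_1} ⋯ [e_d]_{a_d} [e_1 + ⋯ + e_d]_{a_{d+1}}` is a homothety. -/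
theorem exists_eq_smul_id_of_fDisjoint [IsLocalRing S] (hd : 3 ≤ d)
    (ha : FDisjoint F (Fin.cons 1 a : Fin (d + 2) → ℕ)) (e : Module.Basis (Fin d) S M)
    (hv : ∀ i : Fin d, v i.castSucc = e i) (hvl : v (Fin.last d) = ∑ i, e i) (g : M ≃ₗ[S] M)
    (c : S) (hc : IsUnit c) (h : ∏ i, dp S (a i) (g (v i)) = c • ∏ i, dp S (a i) (v i)) :
    ∃ r : S, g.toLinearMap = r • LinearMap.id := by
  obtain ⟨p, hp⟩ := CharP.exists F
  rcases CharP.char_is_prime_or_zero F p with hprime | rfl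
  · have := charP_of_injective_algebraMap (algebraMap F S).injective p
    exact exists_eq_smul_id_of_charP hprime hd e a ha.pos_of_cons _
      (fun i => pow_padicValNat_dvd) (fun i => ha.sum_lt_pow_of_cons hprime i) g.toLinearMap c hc v
      hv hvl h
  · have := CharP.charP_to_charZero F
    let _ : Algebra ℚ S := Algebra.compHom S (algebraMap ℚ F)
    exact exists_eq_smul_id_of_rat hd e a ha.pos_of_cons ha.injective_of_cons g c hc v hv hvl h

end DividedPowerAlgebra

/-! ### Lines in divided powers and base change -/

namespace DivPow

open DividedPowerAlgebra

variable {S M : Type*} [CommRing S] [AddCommGroup M] [Module S M] {s : ℕ}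

theorem map_symbol {N : Type*} [AddCommGroup N] [Module S N] (f : M →ₗ[S] N) (a : Fin s → ℕ)
    (v : Fin s → M) :
    DivPow.map f _ (symbol S a v) = symbol S a fun i => f (v i) := by
  refine Subtype.ext ?_
  change DividedPowerAlgebra.map S f (∏ i, dp S (a i) (v i)) = ∏ i, dp S (a i) (f (v i))
  rw [map_prod]
  simp

theorem baseChange_symbol (T : Type*) [CommRing T] [Algebra S T] (a : Fin s → ℕ) (v : Fin s → M) :
    baseChange T (symbol S a v) = symbol T a fun i => (1 : T) ⊗ₜ[S] v i := by
  refine Subtype.ext ?_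
  change DividedPowerAlgebra.map T (TensorProduct.mk S T M 1) (∏ i, dp S (a i) (v i))
    = ∏ i, dp T (a i) ((1 : T) ⊗ₜ[S] v i)
  rw [map_prod]
  simp

theorem baseChange_smul (T : Type*) [CommRing T] [Algebra S T] {n : ℕ} (r : S)
    (y : DivPow S M n) : baseChange T (r • y) = algebraMap S T r • baseChange T y := by
  refine Subtype.ext ?_
  change DividedPowerAlgebra.map T (TensorProduct.mk S T M 1) (r • y.1)
    = algebraMap S T r • DividedPowerAlgebra.map T (TensorProduct.mk S T M 1) y.1
  rw [Algebra.smul_def, map_mul, AlgHom.commutes, Algebra.smul_def,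
    ← DividedPowerAlgebra.coe_C (R := T) (algebraMap S T r)]
  rfl

theorem extend_span_symbol (T : Type*) [CommRing T] [Algebra S T] (a : Fin s → ℕ)
    (v : Fin s → M) :
    extend T (Submodule.span S {symbol S a v})
      = Submodule.span T {symbol T a fun i => (1 : T) ⊗ₜ[S] v i} := by
  refine le_antisymm (Submodule.span_le.2 ?_) (Submodule.span_mono ?_)
  · rintro _ ⟨y, hy, rfl⟩
    obtain ⟨r, rfl⟩ := Submodule.mem_span_singleton.1 hy
    rw [baseChange_smul, baseChange_symbol]
    exact Submodule.smul_mem _ _ (Submodule.mem_span_singleton_self _)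
  · rw [Set.singleton_subset_iff, ← baseChange_symbol]
    exact ⟨_, Submodule.mem_span_singleton_self _, rfl⟩

theorem coe_symbol (a : Fin s → ℕ) (v : Fin s → M) :
    (symbol S a v : DividedPowerAlgebra S M) = ∏ i, dp S (a i) (v i) := rfl

theorem exists_eq_smul_id_of_map_span_symbol {F : Type*} [Field F] [Algebra F S] [IsLocalRing S]
    {d : ℕ} (hd : 3 ≤ d) {a : Fin (d + 1) → ℕ}
    (ha : FDisjoint F (Fin.cons 1 a : Fin (d + 2) → ℕ)) (e : Module.Basis (Fin d) S M)
    {v : Fin (d + 1) → M} (hv : ∀ i : Fin d, v i.castSucc = e i)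
    (hvl : v (Fin.last d) = ∑ i, e i) (g : M ≃ₗ[S] M)
    (h : (Submodule.span S {symbol S a v}).map (DivPow.map g.toLinearMap _)
      = Submodule.span S {symbol S a v}) :
    ∃ r : S, g.toLinearMap = r • LinearMap.id := by
  rw [Submodule.map_span, Set.image_singleton, map_symbol] at h
  obtain ⟨c, hc⟩ := Submodule.mem_span_singleton.1
    (h ▸ Submodule.mem_span_singleton_self (symbol S a fun i => g.toLinearMap (v i)))
  obtain ⟨c', hc'⟩ := Submodule.mem_span_singleton.1
    (h.symm ▸ Submodule.mem_span_singleton_self (symbol S a v))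
  have hc1 := congrArg Subtype.val hc
  have hc1' := congrArg Subtype.val hc'
  simp only [SetLike.val_smul, coe_symbol] at hc1 hc1'
  -- Equality of the spans only gives `c' * c` fixing the image of `x` under `g`; a unit value of
  -- the pairing at `x` is what allows cancelling to `c' * c = 1`.
  obtain ⟨P, hP⟩ := exists_pairing_isUnit hd ha e hv hvl
  have hcc : c' * c = 1 := by
    have := congrArg (fun y => pairing e.equivFun.toLinearMap y P) hc1'
    simp only [← hc1, pairing_smul] at this
    rw [← mul_assoc] at this
    exact hP.mul_right_cancel (this.trans (one_mul _).symm)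
  exact exists_eq_smul_id_of_fDisjoint hd ha e hv hvl g c
    (IsUnit.of_mul_eq_one_right c' hcc) hc1.symm

end DivPow

/-! ### Automorphisms of `End(M)` are locally inner -/

section PGL

variable {R M ι : Type*} [CommRing R] [AddCommGroup M] [Module R M]

/-- The intertwiner `m ↦ φ(m ⊗ f) v` between the tautological representation of `End(M)` and its
twist by the automorphism `φ`. -/
def PGLPoints.intertwiner (φ : PGLPoints R M) (f : Module.Dual R M) (v : M) : M →ₗ[R] M where
  toFun m := φ (f.smulRight m) v
  map_add' m n := by
    rw [← LinearMap.add_apply, ← map_add]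
    congr 2
    ext
    simp
  map_smul' r m := by
    rw [RingHom.id_apply, ← LinearMap.smul_apply, ← map_smul]
    congr 2
    ext
    simp only [LinearMap.smulRight_apply, LinearMap.smul_apply]
    rw [smul_comm]

theorem PGLPoints.intertwiner_apply (φ : PGLPoints R M) (f : Module.Dual R M) (v m : M) :
    φ.intertwiner f v m = φ (f.smulRight m) v := rfl

theorem PGLPoints.comp_intertwiner (φ : PGLPoints R M) (f : Module.Dual R M) (v : M)
    (h : Module.End R M) : φ h ∘ₗ φ.intertwiner f v = φ.intertwiner f v ∘ₗ h := by
  ext m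
  simp only [LinearMap.comp_apply, PGLPoints.intertwiner_apply]
  rw [← Module.End.mul_apply, ← map_mul]
  congr 2
  ext
  simp

variable [Fintype ι] [DecidableEq ι] (b : Module.Basis ι R M)

/-- If all matrix entries of `φ h` lay in `m`, applying the linear inverse of `φ` would put those of
`h` in `m` as well, including the entry 1. -/
theorem PGLPoints.exists_apply_notMem (φ : PGLPoints R M) (m : Ideal R) (hm : m ≠ ⊤)
    (h : Module.End R M) {i j : ι} (hh : b.coord i (h (b j)) = 1) :
    ∃ (v : M) (l : ι), b.coord l (φ h v) ∉ m := by
  by_contra! H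
  have hsum : φ h = ∑ t, ∑ l, b.coord l (φ h (b t)) • (b.coord t).smulRight (b l) := by
    refine b.ext fun t => ?_
    conv_lhs => rw [← b.sum_repr (φ h (b t))]
    simp only [LinearMap.sum_apply, LinearMap.smul_apply, LinearMap.smulRight_apply,
      Module.Basis.coord_apply, Module.Basis.repr_self, Finsupp.single_apply]
    conv_rhs => rw [Finset.sum_eq_single t (fun s _ hs => by simp [hs.symm]) (by simp)]
    simp
  have h1 : h = ∑ t, ∑ l, b.coord l (φ h (b t)) • φ.symm ((b.coord t).smulRight (b l)) := by
    apply φ.injective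
    conv_lhs => rw [hsum]
    simp [map_sum]
  refine hm ((Ideal.eq_top_iff_one m).2 ?_)
  rw [← hh, h1]
  simp only [LinearMap.sum_apply, LinearMap.smul_apply, map_sum, map_smul, smul_eq_mul]
  exact Ideal.sum_mem _ fun t _ => Ideal.sum_mem _ fun l _ => Ideal.mul_mem_right _ _ (H _ _)

/-- Automorphisms of `End(M)` are inner locally on the base. -/
theorem PGLPoints.exists_det_intertwiner_notMem (φ : PGLPoints R M) (i : ι) (m : Ideal R)
    [m.IsMaximal] : ∃ v : M, LinearMap.det (φ.intertwiner (b.coord i) v) ∉ m := by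
  obtain ⟨v, l, hv⟩ := φ.exists_apply_notMem b m (Ideal.IsMaximal.ne_top ‹_›)
    ((b.coord i).smulRight (b i)) (i := i) (j := i) (by simp)
  refine ⟨v, fun hdet => ?_⟩
  let _ : Field (R ⧸ m) := Ideal.Quotient.field m
  set G := φ.intertwiner (b.coord i) v with hG
  have h0 : ((LinearMap.toMatrix b b G).map (Ideal.Quotient.mk m)).det = 0 := by
    rw [← RingHom.mapMatrix_apply, ← RingHom.map_det, LinearMap.det_toMatrix,
      Ideal.Quotient.eq_zero_iff_mem]
    exact hdet
  obtain ⟨y, hy0, hy⟩ := Matrix.exists_mulVec_eq_zero_iff.2 h0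
  choose x hx using fun t => Ideal.Quotient.mk_surjective (I := m) (y t)
  have hGx : ∀ t, b.coord t (G (∑ s, x s • b s)) ∈ m := by
    intro t
    rw [← Ideal.Quotient.eq_zero_iff_mem]
    have := congrFun hy t
    rw [Matrix.mulVec, dotProduct] at this
    simp only [Matrix.map_apply, LinearMap.toMatrix_apply, Pi.zero_apply] at this
    rw [← this]
    simp [map_sum, hx, mul_comm]
  obtain ⟨t, ht⟩ : ∃ t, y t ≠ 0 := by
    by_contra! H
    exact hy0 (funext H)
  have hxt : x t ∉ m := by
    rwa [← Ideal.Quotient.eq_zero_iff_mem, hx]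
  -- By the intertwining relation, a matrix unit carries a kernel vector `x` of `G` modulo `m` to `x
  -- t • b i`, again in the kernel. But `G (b i) = φ(E_ii) v` was chosen nonzero modulo `m`.
  have hstab : ∀ (h : Module.End R M) (z : M), (∀ s, b.coord s z ∈ m) →
      ∀ s, b.coord s (h z) ∈ m := by
    intro h z hz s
    rw [← b.sum_repr z, map_sum, map_sum]
    refine Ideal.sum_mem _ fun q _ => ?_
    rw [map_smul, map_smul]
    exact Ideal.mul_mem_right _ _ (hz q)
  have h1 := hstab (φ ((b.coord t).smulRight (b i))) _ hGx l
  rw [show φ ((b.coord t).smulRight (b i)) (G (∑ s, x s • b s))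
    = G ((b.coord t).smulRight (b i) (∑ s, x s • b s)) from
      DFunLike.congr_fun (φ.comp_intertwiner _ _ _) _] at h1
  have h2 : (b.coord t).smulRight (b i) (∑ s, x s • b s) = x t • b i := by
    rw [LinearMap.smulRight_apply]
    simp [Finsupp.single_apply]
  rw [h2, map_smul, map_smul, smul_eq_mul] at h1
  exact (Ideal.IsPrime.mem_or_mem inferInstance h1).elim hxt hv

end PGL

/-! ### The stabiliser on points and on the Lie algebra -/

section stabiliser

theorem isUnit_of_eq_smul_id {S N ι : Type*} [CommRing S] [AddCommGroup N] [Module S N]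
    (b : Module.Basis ι S N) (i : ι) (g : N ≃ₗ[S] N) {r : S}
    (hg : g.toLinearMap = r • LinearMap.id) : IsUnit r := by
  refine IsUnit.of_mul_eq_one (b.coord i (g.symm (b i))) ?_
  have h := DFunLike.congr_fun hg (g.symm (b i))
  rw [LinearEquiv.coe_coe, LinearEquiv.apply_symm_apply, LinearMap.smul_apply,
    LinearMap.id_apply] at h
  have := congrArg (b.coord i) h
  rw [map_smul, smul_eq_mul] at this
  rw [← this]
  simp

variable {R M ι : Type*} [CommRing R] [AddCommGroup M] [Module R M]

/-- A lift of the identity commutes with the matrix units, so it is scalar, the scalar being its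
`i`-th diagonal entry. -/
theorem IsLift.exists_eq_smul_id {S : Type*} [CommRing S] [Algebra R S] (b : Module.Basis ι R M)
    (i : ι) {g : (S ⊗[R] M) ≃ₗ[S] (S ⊗[R] M)} (hg : IsLift S g (1 : PGLPoints R M)) :
    ∃ r : S, g.toLinearMap = r • LinearMap.id := by
  refine ⟨(b.baseChange S).coord i (g (b.baseChange S i)), (b.baseChange S).ext fun k => ?_⟩
  have h := DFunLike.congr_fun (hg ((b.coord i).smulRight (b k))) (b.baseChange S i)
  have hE : ∀ z, (((b.coord i).smulRight (b k)).baseChange S) z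
      = (b.baseChange S).coord i z • b.baseChange S k := by
    intro z
    induction z with
    | zero => simp
    | add y z hy hz => rw [map_add, hy, hz, map_add, add_smul]
    | tmul r m =>
      rw [LinearMap.baseChange_tmul, Module.Basis.coord_apply, Module.Basis.baseChange_repr_tmul,
        LinearMap.smulRight_apply, Module.Basis.baseChange_apply, TensorProduct.smul_tmul',
        TensorProduct.tmul_smul, smul_assoc, smul_eq_mul, mul_one, TensorProduct.smul_tmul']
      rfl
  simp only [LinearMap.comp_apply, AlgEquiv.one_apply, hE] at h
  rw [LinearMap.smul_apply, LinearMap.id_apply]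
  refine Eq.trans ?_ h.symm
  simp

end stabiliser

namespace DivPow

open DividedPowerAlgebra

variable {R M : Type*} [CommRing R] [AddCommGroup M] [Module R M]

theorem map_span_symbol_of_eq_smul_id {s : ℕ} (a : Fin s → ℕ) (v : Fin s → M) (g : M →ₗ[R] M)
    {r : R} (hr : IsUnit r) (hg : g = r • LinearMap.id) :
    (Submodule.span R {symbol R a v}).map (DivPow.map g _) = Submodule.span R {symbol R a v} := by
  rw [Submodule.map_span, Set.image_singleton, map_symbol]
  have : (symbol R a fun i => g (v i)) = (∏ i, r ^ a i) • symbol R a v :=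
    Subtype.ext (prod_dp_smul a _ v (fun _ => r) fun i _ => by rw [hg]; rfl)
  rw [this, Submodule.span_singleton_smul_eq]
  rw [IsUnit.prod_univ_iff]
  exact fun i => hr.pow _

end DivPow

theorem lineStabiliser_span_symbol {F : Type u} [Field F] {R : Type w} {M : Type x} [CommRing R]
    [Algebra F R] [AddCommGroup M] [Module R M] {d : ℕ} (hd : 3 ≤ d) {a : Fin (d + 1) → ℕ}
    (ha : FDisjoint F (Fin.cons 1 a : Fin (d + 2) → ℕ)) (b : Module.Basis (Fin d) R M)
    {v : Fin (d + 1) → M} (hv : ∀ i : Fin d, v i.castSucc = b i)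
    (hvl : v (Fin.last d) = ∑ i, b i) :
    lineStabiliser R M (Submodule.span R {DivPow.symbol R a v}) = {1} := by
  have i0 : Fin d := ⟨0, by omega⟩
  refine Set.eq_singleton_iff_unique_mem.2 ⟨?_, fun φ hφ => ?_⟩
  · intro S _ _ g hg
    obtain ⟨r, hr⟩ := hg.exists_eq_smul_id b i0
    rw [DivPow.extend_span_symbol]
    exact DivPow.map_span_symbol_of_eq_smul_id a _ _
      (isUnit_of_eq_smul_id (b.baseChange S) i0 g hr) hr
  · refine AlgEquiv.ext fun f => b.ext fun k => b.ext_elem fun j => ?_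
    rw [AlgEquiv.one_apply, ← sub_eq_zero]
    -- Matrix entries of `φ f - f` may be tested at each maximal ideal, where `φ` has a lift; a
    -- scalar lift makes conjugation trivial.
    refine eq_zero_of_localization _ fun J hJ => ?_
    have := Module.Free.of_basis b
    have := Module.Finite.of_basis b
    obtain ⟨y, hy⟩ := φ.exists_det_intertwiner_notMem b i0 J
    have hu : IsUnit (LinearMap.det
        ((φ.intertwiner (b.coord i0) y).baseChange (Localization.AtPrime J))) := by
      rw [LinearMap.det_baseChange]
      exact IsLocalization.map_units (M := J.primeCompl) _ ⟨_, hy⟩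
    have hlift : IsLift (Localization.AtPrime J) (LinearMap.equivOfIsUnitDet hu) φ := by
      intro h
      have hcoe : (LinearMap.equivOfIsUnitDet hu).toLinearMap = _ :=
        LinearMap.coe_equivOfIsUnitDet hu
      rw [hcoe, ← LinearMap.baseChange_comp, ← LinearMap.baseChange_comp,
        φ.comp_intertwiner]
    have hline := hφ _ _ hlift
    rw [DivPow.extend_span_symbol] at hline
    obtain ⟨r, hr⟩ := DivPow.exists_eq_smul_id_of_map_span_symbol hd ha
      (b.baseChange (Localization.AtPrime J))
      (fun i => by rw [hv, Module.Basis.baseChange_apply])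
      (by simp only [hvl, Module.Basis.baseChange_apply, TensorProduct.tmul_sum]) _ hline
    have hru := isUnit_of_eq_smul_id (b.baseChange _) i0 _ hr
    have hf := DFunLike.congr_fun (hlift f) ((1 : Localization.AtPrime J) ⊗ₜ[R] b k)
    rw [hr] at hf
    simp only [LinearMap.comp_apply, LinearMap.smul_apply, LinearMap.id_apply, map_smul,
      LinearMap.baseChange_tmul] at hf
    have hf' := (hru.smul_left_cancel).1 hf
    have := congrArg (fun z => (b.baseChange (Localization.AtPrime J)).repr z j) hf'
    simp only [Module.Basis.baseChange_repr_tmul] at this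
    rw [map_sub, sub_eq_zero, Algebra.algebraMap_eq_smul_one, Algebra.algebraMap_eq_smul_one]
    exact this

theorem exists_eq_smul_id_of_dualNumber {F : Type u} [Field F] {V : Type v} [AddCommGroup V]
    [Module F V] {d : ℕ} (hd : 3 ≤ d) {a : Fin (d + 1) → ℕ}
    (ha : FDisjoint F (Fin.cons 1 a : Fin (d + 2) → ℕ)) (e : Module.Basis (Fin d) F V)
    {v : Fin (d + 1) → V} (hv : ∀ i : Fin d, v i.castSucc = e i)
    (hvl : v (Fin.last d) = ∑ i, e i) (u : Module.End F V) (c : F)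
    (h : DivPow.map (LinearMap.id + (DualNumber.eps : DualNumber F) • u.baseChange (DualNumber F)) _
          (DivPow.baseChange (DualNumber F) (DivPow.symbol F a v))
        = (1 + c • (DualNumber.eps : DualNumber F))
          • DivPow.baseChange (DualNumber F) (DivPow.symbol F a v)) :
    ∃ b : F, u = b • LinearMap.id := by
  set ε : DualNumber F := DualNumber.eps with hε
  have hεε : ε * ε = 0 := DualNumber.eps_mul_eps
  set U := u.baseChange (DualNumber F) with hU
  have hinv : ∀ s t : DualNumber F, s + t = 0 → s * t = 0 →
      (LinearMap.id + s • U) ∘ₗ (LinearMap.id + t • U) = LinearMap.id := by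
    intro s t hst hst'
    refine LinearMap.ext fun z => ?_
    simp only [LinearMap.comp_apply, LinearMap.add_apply, LinearMap.id_apply, LinearMap.smul_apply,
      map_add, map_smul, smul_smul, mul_comm t s, hst', smul_add, zero_smul, add_zero]
    rw [add_assoc, ← add_smul, hst, zero_smul, add_zero]
  -- The inverse of `1 + ε U` is `1 - ε U`, so the local-ring theorem applies over `F[ε]`; the
  -- `ε`-part of the resulting scalar is the eigenvalue of `u`.
  let g : (DualNumber F ⊗[F] V) ≃ₗ[DualNumber F] (DualNumber F ⊗[F] V) :=
    LinearEquiv.ofLinearMap (LinearMap.id + ε • U) (LinearMap.id + (-ε) • U)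
      (hinv _ _ (by simp) (by simp [hεε])) (hinv _ _ (by simp) (by simp [hεε]))
  rw [DivPow.baseChange_symbol, DivPow.map_symbol] at h
  have hc : IsUnit (1 + c • ε) := by
    refine IsUnit.of_mul_eq_one (1 - c • ε) ?_
    have : (c • ε) * (c • ε) = 0 := by rw [smul_mul_smul_comm, hεε, smul_zero]
    linear_combination -this
  obtain ⟨r, hr⟩ := DividedPowerAlgebra.exists_eq_smul_id_of_fDisjoint hd ha
    (e.baseChange (DualNumber F)) (v := fun i => (1 : DualNumber F) ⊗ₜ[F] v i)
    (fun i => by rw [hv, Module.Basis.baseChange_apply])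
    (by simp only [hvl, Module.Basis.baseChange_apply, TensorProduct.tmul_sum]) g _ hc
    (congrArg Subtype.val h)
  refine ⟨r.snd, e.ext fun k => e.ext_elem fun j => ?_⟩
  have h1 : LinearMap.id + ε • U = r • LinearMap.id := hr
  have h2 := DFunLike.congr_fun h1 ((1 : DualNumber F) ⊗ₜ[F] e k)
  have h3 := congrArg (fun z => TrivSqZeroExt.snd ((e.baseChange (DualNumber F)).repr z j)) h2
  simp only [LinearMap.add_apply, LinearMap.id_apply, LinearMap.smul_apply, hU, hε,
    LinearMap.baseChange_tmul, TensorProduct.smul_tmul', map_add, Finsupp.add_apply,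
    Module.Basis.baseChange_repr_tmul, Module.Basis.repr_self, Finsupp.single_apply,
    TrivSqZeroExt.snd_add, TrivSqZeroExt.snd_smul] at h3
  rw [LinearMap.smul_apply, LinearMap.id_apply, map_smul, Finsupp.smul_apply,
    Module.Basis.repr_self, Finsupp.single_apply]
  simpa [mul_comm] using h3

theorem mainTheorem7 {F : Type u} [Field F] {V : Type v} [AddCommGroup V] [Module F V]
    (d : ℕ) (hd : 3 ≤ d) (e : Module.Basis (Fin d) F V)
    (a : Fin (d + 1) → ℕ)
    (ha : FDisjoint F (Fin.cons 1 a : Fin (d + 2) → ℕ))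
    (x : DivPow F V (∑ i, a i))
    (hx : x = DivPow.symbol F a (Fin.snoc (fun i => e i) (∑ i, e i) : Fin (d + 1) → V)) :
    x ≠ 0 ∧
    -- the scheme-theoretic stabiliser in `PGL(V)` of the line of `x`, on points in all `F`-algebras
    (∀ (R : Type w) [CommRing R] [Algebra F R],
      lineStabiliser R (R ⊗[F] V) (DivPow.extend R (Submodule.span F {x})) = {1}) ∧
    -- on geometric points
    (∀ (K : Type w) [Field K] [IsAlgClosed K] [Algebra F K] (g : (K ⊗[F] V) ≃ₗ[K] (K ⊗[F] V)),
      (DivPow.extend K (Submodule.span F {x})).map (DivPow.map g.toLinearMap _)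
        = DivPow.extend K (Submodule.span F {x}) →
      ∃ c : K, g.toLinearMap = c • LinearMap.id) ∧
    -- on Lie algebras
    (∀ (u : Module.End F V) (c : F),
      DivPow.map (LinearMap.id + (DualNumber.eps : DualNumber F) • u.baseChange (DualNumber F)) _
          (DivPow.baseChange (DualNumber F) x)
        = (1 + c • (DualNumber.eps : DualNumber F)) • DivPow.baseChange (DualNumber F) x →
      ∃ b : F, u = b • LinearMap.id) := by
  subst hx
  set v : Fin (d + 1) → V := Fin.snoc (fun i => e i) (∑ i, e i) with hvdef
  have hv : ∀ i : Fin d, v i.castSucc = e i := fun i => by simp [hvdef]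
  have hvl : v (Fin.last d) = ∑ i, e i := by simp [hvdef]
  refine ⟨fun h0 => ?_, fun R _ _ => ?_, fun K _ _ _ g hg => ?_, fun u c h => ?_⟩
  · obtain ⟨P, hP⟩ := DividedPowerAlgebra.exists_pairing_isUnit hd ha e hv hvl
    have h1 : ∏ i, DividedPowerAlgebra.dp F (a i) (v i) = 0 := congrArg Subtype.val h0
    rw [h1, ← zero_smul F (0 : DividedPowerAlgebra F V), DividedPowerAlgebra.pairing_smul,
      zero_mul] at hP
    exact not_isUnit_zero hP
  · rw [DivPow.extend_span_symbol]
    exact lineStabiliser_span_symbol hd ha (e.baseChange R)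
      (fun i => by rw [hv, Module.Basis.baseChange_apply])
      (by simp only [hvl, Module.Basis.baseChange_apply, TensorProduct.tmul_sum])
  · rw [DivPow.extend_span_symbol] at hg
    exact DivPow.exists_eq_smul_id_of_map_span_symbol hd ha (e.baseChange K)
      (fun i => by rw [hv, Module.Basis.baseChange_apply])
      (by simp only [hvl, Module.Basis.baseChange_apply, TensorProduct.tmul_sum]) g hg
  · exact exists_eq_smul_id_of_dualNumber hd ha e hv hvl u c h
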